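/- For a permutation $\sigma=\sigma_1\cdots\sigma_N$ of $[N]=\{1,\dots,N\}$, a descent is a pair $(\sigma_i,\sigma_{i+1})$ with $1\le i<N$ and $\sigma_i>\sigma_{i+1}$; $\sigma_i$ is its descent top and $\sigma_{i+1}$ its descent bottom. Let - $\mathrm{des}\,\sigma$ be the number of descents of $\sigma$; - $\mathrm{lema}\,\sigma$ (resp. $\mathrm{loma}\,\sigma$) be the number of even (resp. odd) left-to-right maxima, i.e. values $\sigma_i$ with $\sigma_j<\sigma_i$ for all $j<i$; - $\mathrm{remi}\,\sigma$ (resp. $\mathrm{romi}\,\sigma$) be the number of even (resp. odd) right-to-left minima, i.e. values $\sigma_i$ with $\sigma_i<\sigma_j$ for all $j>i$; - $\mathrm{les}\,\sigma$ be the number of pairs $(i,j)$ with $2\le i<j\le N$ and $\sigma_{i-1}>\sigma_j>\sigma_i$; - $\mathrm{res}_{\downarrow}\,\sigma$ be the number of pairs $(i,j)$ with $1\le i<j\le N-1$ and $\sigma_j>\sigma_i>\sigma_{j+1}$; - $\mathrm{res}_{\uparrow}\,\sigma$ be the number of pairs $(i,j)$ with $1\le i<j\le N-1$ and $\sigma_{j+1}>\sigma_i>\sigma_j$;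 - $\mathrm{dd}\,\sigma$ be the number of double descents, i.e. indices $1\le i\le N$ with $\sigma_{i-1}>\sigma_i>\sigma_{i+1}$, where $\sigma_0=\sigma_{N+1}=0$; - $\mathrm{dom}\,\sigma$ (for $N=2n$) be the number of $j\in[n]$ such that $2j$ is a descent top and $2j-1$ is a descent bottom of $\sigma$ (not necessarily of the same descent). Let $\mathcal X_{2n}$ be the set of permutations of $[2n]$ all of whose descents have an even top and an odd bottom, and let $\mathcal Y^*_{2n+1}$ be the set of permutations of $[2n+1]$ all of whose descents have an odd top and an odd bottom and whose last entry is odd. Define $$X_n(a,\bar a,b,\bar b,p,q,y,t)=\sum_{\sigma\in\mathcal X_{2n}}a^{\mathrm{lema}\,\sigma}\,\bar a^{\mathrm{loma}\,\sigma}\,b^{\mathrm{romi}\,\sigma}\,\bar b^{\mathrm{remi}\,\sigma}\,p^{\mathrm{res}_{\downarrow}\sigma}\,q^{\mathrm{les}\,\sigma}\,y^{\mathrm{dom}\,\sigma}\,t^{\mathrm{des}\,\sigma},$$ $$Y_n(a,p,q,y,t)=\sum_{\sigma\in\mathcal Y^*_{2n+1}}a^{\mathrm{lema}\,\sigma}\,p^{\mathrm{res}_{\uparrow}\sigma}\,q^{\mathrm{les}\,\sigma}\,y^{\mathrm{dd}\,\sigma}\,t^{\mathrm{des}\,\sigma}.$$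 **Theorem.** For every $n\ge 1$, $$Y_n(a,p,q,y,t)=X_n(a,1,1,1,p,q,y,t)$$ as polynomials with integer coefficients; equivalently, for all elements $a,p,q,y,t$ of every commutative ring. -/

import Mathlib

namespace Genocchi

open Finset

/-- The one-line notation `σ₁ ⋯ σ_N` of a permutation of `[N] = {1, …, N}`: `entry σ k` is `σ_k`
for `1 ≤ k ≤ N`, and `entry σ k = 0` otherwise (so that `σ₀ = σ_{N+1} = 0`). -/
def entry {N : ℕ} (σ : Equiv.Perm (Fin N)) (k : ℕ) : ℕ :=
  if h : 1 ≤ k ∧ k ≤ N then (σ ⟨k - 1, by omega⟩ : ℕ) + 1 else 0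

/-- The position `i` (with `1 ≤ i < N`) carries a descent: `σ_i > σ_{i+1}`. -/
def IsDescentAt {N : ℕ} (σ : Equiv.Perm (Fin N)) (i : ℕ) : Prop :=
  i ∈ Ico 1 N ∧ entry σ i > entry σ (i + 1)

instance {N : ℕ} (σ : Equiv.Perm (Fin N)) (i : ℕ) : Decidable (IsDescentAt σ i) := by
  unfold IsDescentAt; infer_instance

/-- The number of descents. -/
def des {N : ℕ} (σ : Equiv.Perm (Fin N)) : ℕ :=
  #{i ∈ Ico 1 N | IsDescentAt σ i}

/-- The value `v` is a descent top. -/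
def IsDescentTop {N : ℕ} (σ : Equiv.Perm (Fin N)) (v : ℕ) : Prop :=
  ∃ i ∈ Ico 1 N, IsDescentAt σ i ∧ entry σ i = v

/-- The value `v` is a descent bottom. -/
def IsDescentBottom {N : ℕ} (σ : Equiv.Perm (Fin N)) (v : ℕ) : Prop :=
  ∃ i ∈ Ico 1 N, IsDescentAt σ i ∧ entry σ (i + 1) = v

instance {N : ℕ} (σ : Equiv.Perm (Fin N)) (v : ℕ) : Decidable (IsDescentTop σ v) := by
  unfold IsDescentTop; infer_instance

instance {N : ℕ} (σ : Equiv.Perm (Fin N)) (v : ℕ) : Decidable (IsDescentBottom σ v) := by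
  unfold IsDescentBottom; infer_instance

/-- `σ_i` is a left-to-right maximum. -/
def IsLeftToRightMax {N : ℕ} (σ : Equiv.Perm (Fin N)) (i : ℕ) : Prop :=
  ∀ j ∈ Ico 1 i, entry σ j < entry σ i

/-- `σ_i` is a right-to-left minimum. -/
def IsRightToLeftMin {N : ℕ} (σ : Equiv.Perm (Fin N)) (i : ℕ) : Prop :=
  ∀ j ∈ Ioc i N, entry σ i < entry σ j

instance {N : ℕ} (σ : Equiv.Perm (Fin N)) (i : ℕ) : Decidable (IsLeftToRightMax σ i) := by
  unfold IsLeftToRightMax; infer_instance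

instance {N : ℕ} (σ : Equiv.Perm (Fin N)) (i : ℕ) : Decidable (IsRightToLeftMin σ i) := by
  unfold IsRightToLeftMin; infer_instance

/-- The number of even left-to-right maxima. -/
def lema {N : ℕ} (σ : Equiv.Perm (Fin N)) : ℕ :=
  #{i ∈ Icc 1 N | IsLeftToRightMax σ i ∧ Even (entry σ i)}

/-- The number of odd left-to-right maxima. -/
def loma {N : ℕ} (σ : Equiv.Perm (Fin N)) : ℕ :=
  #{i ∈ Icc 1 N | IsLeftToRightMax σ i ∧ Odd (entry σ i)}

/-- The number of even right-to-left minima. -/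
def remi {N : ℕ} (σ : Equiv.Perm (Fin N)) : ℕ :=
  #{i ∈ Icc 1 N | IsRightToLeftMin σ i ∧ Even (entry σ i)}

/-- The number of odd right-to-left minima. -/
def romi {N : ℕ} (σ : Equiv.Perm (Fin N)) : ℕ :=
  #{i ∈ Icc 1 N | IsRightToLeftMin σ i ∧ Odd (entry σ i)}

/-- The number of pairs `(i, j)` with `2 ≤ i < j ≤ N` and `σ_{i-1} > σ_j > σ_i`. -/
def les {N : ℕ} (σ : Equiv.Perm (Fin N)) : ℕ :=
  #{x ∈ Icc 2 N ×ˢ Icc 2 N | x.1 < x.2 ∧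
    entry σ (x.1 - 1) > entry σ x.2 ∧ entry σ x.2 > entry σ x.1}

/-- The number of pairs `(i, j)` with `1 ≤ i < j ≤ N - 1` and `σ_j > σ_i > σ_{j+1}`:
the right embracings by descents, used for even-odd descent permutations. -/
def resDesc {N : ℕ} (σ : Equiv.Perm (Fin N)) : ℕ :=
  #{x ∈ Ico 1 N ×ˢ Ico 1 N | x.1 < x.2 ∧
    entry σ x.2 > entry σ x.1 ∧ entry σ x.1 > entry σ (x.2 + 1)}

/-- The number of pairs `(i, j)` with `1 ≤ i < j ≤ N - 1` and `σ_{j+1} > σ_i > σ_j`: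
the right embracings by ascents, used for odd-odd descent permutations. -/
def resAsc {N : ℕ} (σ : Equiv.Perm (Fin N)) : ℕ :=
  #{x ∈ Ico 1 N ×ˢ Ico 1 N | x.1 < x.2 ∧
    entry σ (x.2 + 1) > entry σ x.1 ∧ entry σ x.1 > entry σ x.2}

/-- The number of double descents `σ_{i-1} > σ_i > σ_{i+1}`, with `σ₀ = σ_{N+1} = 0`. -/
def dd {N : ℕ} (σ : Equiv.Perm (Fin N)) : ℕ :=
  #{i ∈ Icc 1 N | entry σ (i - 1) > entry σ i ∧ entry σ i > entry σ (i + 1)}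

/-- The number of dominos: indices `j ∈ [n]` such that `2j` is a descent top and `2j - 1` is a
descent bottom (not necessarily of the same descent). -/
def dom {n : ℕ} (σ : Equiv.Perm (Fin (2 * n))) : ℕ :=
  #{j ∈ Icc 1 n | IsDescentTop σ (2 * j) ∧ IsDescentBottom σ (2 * j - 1)}

/-- The even-odd descent permutations of `[2n]`: every descent has even top and odd bottom. -/
def evenOddPerms (n : ℕ) : Finset (Equiv.Perm (Fin (2 * n))) :=
  {σ | ∀ i ∈ Ico 1 (2 * n), IsDescentAt σ i → Even (entry σ i) ∧ Odd (entry σ (i + 1))}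

/-- The odd-odd descent permutations of `[2n+1]`: every descent has odd top and odd bottom. -/
def oddOddPerms (n : ℕ) : Finset (Equiv.Perm (Fin (2 * n + 1))) :=
  {σ | ∀ i ∈ Ico 1 (2 * n + 1), IsDescentAt σ i → Odd (entry σ i) ∧ Odd (entry σ (i + 1))}

/-- The odd-odd descent permutations of `[2n+1]` whose last entry is odd. -/
def oddOddPermsStar (n : ℕ) : Finset (Equiv.Perm (Fin (2 * n + 1))) :=
  {σ ∈ oddOddPerms n | Odd (entry σ (2 * n + 1))}

/-- The polynomial `X_n(a, a', b, b', p, q, y, t)`, with its variables in any commutative ring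
(in particular, they may be the indeterminates of a polynomial ring). -/
def polyX {R : Type*} [CommRing R] (n : ℕ) (a a' b b' p q y t : R) : R :=
  ∑ σ ∈ evenOddPerms n,
    a ^ lema σ * a' ^ loma σ * b ^ romi σ * b' ^ remi σ *
      p ^ resDesc σ * q ^ les σ * y ^ dom σ * t ^ des σ

/-- The polynomial `Y_n(a, p, q, y, t)`, with its variables in any commutative ring. -/
def polyY {R : Type*} [CommRing R] (n : ℕ) (a p q y t : R) : R :=
  ∑ σ ∈ oddOddPermsStar n,
    a ^ lema σ * p ^ resAsc σ * q ^ les σ * y ^ dd σ * t ^ des σ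

end Genocchi

namespace Genocchi

open Finset

/-! Both polynomials are computed by inserting the letters 1, 2, … in increasing order. After 1, …,
v are placed, each maximal block of larger letters still to come is recorded as one gap, the
placeholder `M`, which exceeds every letter. Inserting v + 1 in one of K gaps leaves a gap, or not,
on each of its sides, so K changes by -1, 0, 0 or +1. Every permutation arises from exactly one
sequence of insertions.

If v + 1 is inserted with i gaps on its left and j = K - 1 - i on its right, then i counts the
descents that straddle it on its left and j the ascents that straddle it on its right. The remaining
gaps beside v + 1 tell which of its neighbours are larger. Later insertions change none of this
(`stats_replace`, `stats_fillGap`). Hence a weight that is a product over letters of such data is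
summed by a recursion in K, `transfer` (`sum_permutations_eq_transfer`). One Boolean remembers
whether the previous letter is a descent bottom, as dominos require.

For X, the letter 2n + 1 is first appended to every permutation. It turns ascents straddling u on
the right into descents straddling u, up to a correction of 1 when u is a descent top.

Write T for the sums after two more letters, [K] for the (p, q)-number and [K]' for the same with
first term multiplied by a. An odd letter followed by an even one gives, for X, [K] ([K]' T(K) +
[K-1]' T(K-1) + t ([K+1]' T(K+1) + y [K]' T(K))), and for Y, with F(K) = [K]' T(K), [K] (F(K-1) +
F(K) + t y F(K) + t F(K+1)). These agree: a domino in X plays the part of a double descent in Y. The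
last letter 2n + 1 fills the only gap with weight 1 in both cases. -/

/-- Two consecutive letters of a word are not both the placeholder `M`. -/
def NotBoth (M x y : ℕ) : Prop := ¬(x = M ∧ y = M)

/-- The optional placeholder. -/
def pad (M : ℕ) (b : Bool) : List ℕ := if b then [M] else []

/-- Insertion of the letter `v` in the gap between `l` and `r`; the Booleans say whether a gap
remains on its left and on its right. -/
def fillGap (M v : ℕ) (l r : List ℕ) (b c : Bool) : List ℕ := l ++ pad M b ++ v :: (pad M c ++ r)

/-- All ways to write a word as `l ++ M :: r`. -/
def splits (M : ℕ) : List ℕ → List (List ℕ × List ℕ)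
  | [] => []
  | x :: w => (if x = M then [([], w)] else []) ++ (splits M w).map fun z => (x :: z.1, z.2)

/-- The four insertions of `v` in a gap. -/
def fillings (M v : ℕ) (z : List ℕ × List ℕ) : List (List ℕ) :=
  [fillGap M v z.1 z.2 false false, fillGap M v z.1 z.2 false true,
    fillGap M v z.1 z.2 true false, fillGap M v z.1 z.2 true true]

/-- The words obtained from `[M]` by inserting `1, …, v` successively in gaps. -/
def gapWords (M : ℕ) : ℕ → List (List ℕ)
  | 0 => [[M]]
  | v + 1 => ((gapWords M v).flatMap (splits M)).flatMap (fillings M (v + 1))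

/-- The nonempty words with letters `1, …, v`, each once, and placeholders that are not
adjacent. -/
def IsGapWord (M v : ℕ) (w : List ℕ) : Prop :=
  w.IsChain (NotBoth M) ∧ (w.filter (· ≠ M)).Perm (List.range' 1 v) ∧ w ≠ []

/-! ### Gap words: each arises from exactly one sequence of insertions -/

theorem mem_splits {M : ℕ} {w l r : List ℕ} : (l, r) ∈ splits M w ↔ w = l ++ M :: r := by
  induction w generalizing l with
  | nil => simp [splits]
  | cons x w ih =>
    rw [splits, List.mem_append, List.mem_map]
    constructor
    · rintro (h | ⟨⟨l', r'⟩, h, h'⟩)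
      · split_ifs at h with hx
        · simp_all
        · simp at h
      · obtain ⟨rfl, rfl⟩ := Prod.mk.inj h'
        simp [ih.1 h]
    · intro h
      cases l with
      | nil => simp_all
      | cons y l =>
        simp only [List.cons_append, List.cons.injEq] at h
        obtain ⟨rfl, h⟩ := h
        exact Or.inr ⟨(l, r), ih.2 h, rfl⟩

theorem nodup_splits (M : ℕ) (w : List ℕ) : (splits M w).Nodup := by
  induction w with
  | nil => simp [splits]
  | cons x w ih =>
    rw [splits, List.nodup_append]
    refine ⟨by split_ifs <;> simp, ih.map ?_, ?_⟩
    · rintro ⟨a, b⟩ ⟨c, d⟩ h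
      simpa using h
    · intro a ha b hb
      split_ifs at ha
      · simp only [List.mem_singleton] at ha
        simp only [List.mem_map] at hb
        obtain ⟨z, -, rfl⟩ := hb
        simp [ha]
      · simp at ha

/-- The placeholder of index i, from the left and starting at 0, has i others before it and the rest
after it. This is what makes the recursion depend on a word only through its number of gaps. -/
theorem sum_splits {R : Type*} [CommRing R] (M : ℕ) (w : List ℕ) (g : ℕ → ℕ → R) :
    ((splits M w).map fun z => g (z.1.count M) (z.2.count M)).sum =
      ∑ i ∈ range (w.count M), g i (w.count M - 1 - i) := by
  induction w generalizing g with
  | nil => simp [splits]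
  | cons x w ih =>
    rw [splits, List.map_append, List.sum_append, List.map_map]
    by_cases hx : x = M
    · subst hx
      have := ih fun i j => g (i + 1) j
      simp only [Function.comp_def, List.count_cons_self, ↓reduceIte, List.map_cons, List.map_nil,
        List.sum_cons, List.sum_nil, List.count_nil, add_zero, this]
      rw [sum_range_succ', add_comm]
      congr 1
      exact sum_congr rfl fun i hi => by congr 1; omega
    · simpa [hx, Function.comp_def, List.count_cons] using ih g

theorem isChain_replace_right {M x : ℕ} {l : List ℕ} (hx : x ≠ M) (h : l.IsChain (NotBoth M)) :
    (l ++ [x]).IsChain (NotBoth M) := by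
  rw [List.isChain_append]
  refine ⟨h, by simp, ?_⟩
  intro a _ b hb
  simp only [List.head?_cons, Option.mem_def, Option.some.injEq] at hb
  subst hb
  exact fun h => hx h.2

theorem isChain_replace_left {M x : ℕ} {l : List ℕ} (hx : x ≠ M) (h : l.IsChain (NotBoth M)) :
    (x :: l).IsChain (NotBoth M) := by
  cases l with
  | nil => simp
  | cons y l =>
    rw [List.isChain_cons_cons]
    exact ⟨fun h => hx h.1, h⟩

theorem isChain_fillGap_iff {M v : ℕ} (hv : v ≠ M) (l r : List ℕ) (b c : Bool) :
    (fillGap M v l r b c).IsChain (NotBoth M) ↔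
      (l ++ pad M b).IsChain (NotBoth M) ∧ (pad M c ++ r).IsChain (NotBoth M) := by
  rw [fillGap, List.isChain_split]
  refine and_congr ⟨fun h => (List.isChain_append.1 h).1, isChain_replace_right hv⟩
    ⟨fun h => ?_, isChain_replace_left hv⟩
  exact (List.isChain_append (l₁ := [v]).1 h).2.1

theorem filter_fillGap {M v : ℕ} (hv : v ≠ M) (l r : List ℕ) (b c : Bool) :
    ((fillGap M v l r b c).filter (· ≠ M)).Perm (v :: (l ++ M :: r).filter (· ≠ M)) := by
  have : ((fillGap M v l r b c).filter (· ≠ M)) =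
      l.filter (· ≠ M) ++ v :: r.filter (· ≠ M) := by
    cases b <;> cases c <;> simp [fillGap, pad, hv]
  rw [this]
  simp

theorem perm_range'_succ_iff {v : ℕ} {w : List ℕ} :
    ((v + 1) :: w).Perm (List.range' 1 (v + 1)) ↔ w.Perm (List.range' 1 v) := by
  rw [← List.perm_cons (v + 1) (l₁ := w)]
  have : (List.range' 1 (v + 1)).Perm ((v + 1) :: List.range' 1 v) := by
    rw [List.range'_concat]
    simp [add_comm]
  exact ⟨fun h => h.trans this, fun h => h.trans this.symm⟩

theorem IsGapWord.mem {M v : ℕ} {w : List ℕ} (h : IsGapWord M v w) {x : ℕ} (hx : x ∈ w) :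
    x ≤ v ∨ x = M := by
  by_cases hM : x = M
  · exact Or.inr hM
  · have : x ∈ w.filter (· ≠ M) := by simp [hx, hM]
    rw [h.2.1.mem_iff, List.mem_range'_1] at this
    exact Or.inl (by omega)

theorem IsGapWord.fillGap {M v : ℕ} (hv : v + 1 ≠ M) {l r : List ℕ}
    (h : IsGapWord M v (l ++ M :: r)) (b c : Bool) :
    IsGapWord M (v + 1) (fillGap M (v + 1) l r b c) := by
  obtain ⟨h1, h2, -⟩ := h
  rw [List.isChain_split] at h1
  refine ⟨(isChain_fillGap_iff hv l r b c).2 ⟨?_, ?_⟩, ?_, by simp [Genocchi.fillGap]⟩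
  · cases b
    · simpa [pad] using (List.isChain_append.1 h1.1).1
    · exact h1.1
  · cases c
    · simpa [pad] using (List.isChain_append (l₁ := [M]).1 h1.2).2.1
    · exact h1.2
  · exact (filter_fillGap hv l r b c).trans (perm_range'_succ_iff.2 h2)

theorem exists_strip_right {M : ℕ} {l : List ℕ} (h : l.IsChain (NotBoth M)) :
    ∃ l' b, l = l' ++ pad M b ∧ (l' ++ [M]).IsChain (NotBoth M) := by
  rcases List.eq_nil_or_concat l with rfl | ⟨l', x, rfl⟩
  · exact ⟨[], false, by simp [pad], by simp⟩
  · by_cases hx : x = M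
    · subst hx
      exact ⟨l', true, by simp [pad], by simpa using h⟩
    · refine ⟨l' ++ [x], false, by simp [pad], ?_⟩
      rw [List.isChain_append]
      refine ⟨by simpa using h, by simp, ?_⟩
      simp [NotBoth, hx]

theorem exists_strip_left {M : ℕ} {r : List ℕ} (h : r.IsChain (NotBoth M)) :
    ∃ r' c, r = pad M c ++ r' ∧ (M :: r').IsChain (NotBoth M) := by
  rcases r with _ | ⟨x, r'⟩
  · exact ⟨[], false, by simp [pad], by simp⟩
  · by_cases hx : x = M
    · subst hx
      exact ⟨r', true, by simp [pad], h⟩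
    · refine ⟨x :: r', false, by simp [pad], ?_⟩
      rw [List.isChain_cons_cons]
      exact ⟨fun h => hx h.2, h⟩

/-- Insertion is undone by replacing v + 1, together with any placeholders next to it, by a single
placeholder. -/
theorem IsGapWord.exists_fillGap {M v : ℕ} (hv : v + 1 ≠ M) {w : List ℕ}
    (h : IsGapWord M (v + 1) w) :
    ∃ l r b c, IsGapWord M v (l ++ M :: r) ∧ w = Genocchi.fillGap M (v + 1) l r b c := by
  have hm : v + 1 ∈ w := by
    have : v + 1 ∈ w.filter (· ≠ M) := by rw [h.2.1.mem_iff, List.mem_range'_1]; omega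
    exact (List.mem_filter.1 this).1
  obtain ⟨l₀, r₀, rfl⟩ := List.append_of_mem hm
  have hc := List.isChain_split.1 h.1
  obtain ⟨l, b, rfl, hl⟩ := exists_strip_right (List.isChain_append.1 hc.1).1
  obtain ⟨r, c, rfl, hr⟩ := exists_strip_left (List.isChain_append (l₁ := [v + 1]).1 hc.2).2.1
  refine ⟨l, r, b, c, ⟨List.isChain_split.2 ⟨hl, hr⟩, ?_, by simp⟩, rfl⟩
  exact perm_range'_succ_iff.1 ((filter_fillGap hv l r b c).symm.trans h.2.1)

theorem mem_fillings {M v : ℕ} {z : List ℕ × List ℕ} {w : List ℕ} :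
    w ∈ fillings M v z ↔ ∃ b c, w = fillGap M v z.1 z.2 b c := by
  simp [fillings, or_assoc]

theorem mem_gapWords {M v : ℕ} (hv : v < M) {w : List ℕ} :
    w ∈ gapWords M v ↔ IsGapWord M v w := by
  induction v generalizing w with
  | zero =>
    simp only [gapWords, List.mem_singleton, IsGapWord, List.range'_zero, List.perm_nil]
    constructor
    · rintro rfl
      simp
    · rintro ⟨h1, h2, h3⟩
      simp only [ne_eq, decide_not, List.filter_eq_nil_iff, Bool.not_eq_true', decide_eq_false_iff_not,
        not_not] at h2
      match w, h3 with
      | [x], _ => simpa using h2 x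
      | x :: y :: w, _ => exact absurd ⟨h2 x (by simp), h2 y (by simp)⟩ (List.isChain_cons_cons.1 h1).1
  | succ v ih =>
    simp only [gapWords, List.mem_flatMap, mem_fillings]
    constructor
    · rintro ⟨⟨l, r⟩, ⟨w', hw', hz⟩, b, c, rfl⟩
      rw [mem_splits] at hz
      subst hz
      exact ((ih (by omega)).1 hw').fillGap hv.ne b c
    · intro h
      obtain ⟨l, r, b, c, h', rfl⟩ := h.exists_fillGap hv.ne
      exact ⟨(l, r), ⟨_, (ih (by omega)).2 h', mem_splits.2 rfl⟩, b, c, rfl⟩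

/-- Since `l ++ [M]` has no two adjacent placeholders, `l` does not end in `M`; so the Boolean can
be read off the last letter. -/
theorem strip_right_unique {M : ℕ} {l l' : List ℕ} {b b' : Bool}
    (hl : (l ++ [M]).IsChain (NotBoth M)) (hl' : (l' ++ [M]).IsChain (NotBoth M))
    (h : l ++ pad M b = l' ++ pad M b') : l = l' ∧ b = b' := by
  have key : ∀ {l : List ℕ}, ¬ ((l ++ [M]) ++ [M]).IsChain (NotBoth M) := by
    intro l h
    rw [List.isChain_append] at h
    simp [NotBoth] at h
  cases b <;> cases b' <;> simp [pad] at h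
  · exact ⟨h, rfl⟩
  · subst h; exact (key hl).elim
  · subst h; exact (key hl').elim
  · exact ⟨h, rfl⟩

theorem strip_left_unique {M : ℕ} {r r' : List ℕ} {c c' : Bool}
    (hr : (M :: r).IsChain (NotBoth M)) (hr' : (M :: r').IsChain (NotBoth M))
    (h : pad M c ++ r = pad M c' ++ r') : r = r' ∧ c = c' := by
  cases c <;> cases c' <;> simp [pad] at h
  · exact ⟨h, rfl⟩
  · subst h; simp [NotBoth] at hr
  · subst h; simp [NotBoth] at hr'
  · exact ⟨h, rfl⟩

theorem IsGapWord.notMem {M v : ℕ} (hv : v + 1 ≠ M) {l r : List ℕ}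
    (h : IsGapWord M v (l ++ M :: r)) :
    (∀ b, v + 1 ∉ l ++ pad M b) ∧ ∀ c, v + 1 ∉ pad M c ++ r := by
  have : v + 1 ∉ l ++ M :: r := fun hm => by rcases h.mem hm with h | h <;> omega
  constructor <;> intro b <;> cases b <;> simp_all [pad]

/-- The letter v + 1 is new, so its unique occurrence shows where to cut; the adjacent placeholders
then determine both Booleans. -/
theorem fillGap_inj {M v : ℕ} (hv : v + 1 ≠ M) {l r l' r' : List ℕ} {b c b' c' : Bool}
    (h : IsGapWord M v (l ++ M :: r)) (h' : IsGapWord M v (l' ++ M :: r'))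
    (he : fillGap M (v + 1) l r b c = fillGap M (v + 1) l' r' b' c') :
    (l = l' ∧ r = r') ∧ b = b' ∧ c = c' := by
  rw [fillGap, fillGap, List.append_cons_inj_of_notMem ((h.notMem hv).1 b)
    ((h.notMem hv).2 c)] at he
  have hc := List.isChain_split.1 h.1
  have hc' := List.isChain_split.1 h'.1
  obtain ⟨h1, h2⟩ := strip_right_unique hc.1 hc'.1 he.1
  obtain ⟨h3, h4⟩ := strip_left_unique hc.2 hc'.2 he.2.2
  exact ⟨⟨h1, h3⟩, h2, h4⟩

theorem nodup_gapWords {M v : ℕ} (hv : v < M) : (gapWords M v).Nodup := by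
  induction v with
  | zero => simp [gapWords]
  | succ v ih =>
    have hZ : ((gapWords M v).flatMap (splits M)).Nodup := by
      rw [List.nodup_flatMap]
      refine ⟨fun w _ => nodup_splits M w, (ih (by omega)).imp ?_⟩
      rintro w w' hne ⟨l, r⟩ h h'
      exact hne ((mem_splits.1 h).trans (mem_splits.1 h').symm)
    have hm : ∀ {l r}, (l, r) ∈ (gapWords M v).flatMap (splits M) →
        IsGapWord M v (l ++ M :: r) := by
      intro l r h
      obtain ⟨w, hw, hs⟩ := List.mem_flatMap.1 h
      rw [mem_splits] at hs
      exact hs ▸ (mem_gapWords (by omega)).1 hw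
    rw [gapWords, List.nodup_flatMap]
    refine ⟨?_, ?_⟩
    · rintro ⟨l, r⟩ hz
      have key : ∀ b c b' c', (b, c) ≠ (b', c') →
          fillGap M (v + 1) l r b c ≠ fillGap M (v + 1) l r b' c' := by
        intro b c b' c' hne he
        obtain ⟨-, rfl, rfl⟩ := fillGap_inj hv.ne (hm hz) (hm hz) he
        exact hne rfl
      simp [fillings, key]
    · refine hZ.imp_of_mem ?_
      rintro ⟨l, r⟩ ⟨l', r'⟩ hz hz' hne w h h'
      obtain ⟨b, c, rfl⟩ := mem_fillings.1 h
      obtain ⟨b', c', he⟩ := mem_fillings.1 h'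
      obtain ⟨⟨rfl, rfl⟩, -⟩ := fillGap_inj hv.ne (hm hz) (hm hz') he
      exact hne rfl

/-! ### Straddling statistics of a letter and their stability under insertion -/

/-- The part of a word before the first occurrence of `u`. -/
def before (u : ℕ) : List ℕ → List ℕ
  | [] => []
  | x :: w => if x = u then [] else x :: before u w

/-- The part of a word after the first occurrence of `u`. -/
def after (u : ℕ) : List ℕ → List ℕ
  | [] => []
  | x :: w => if x = u then w else after u w

/-- The first letter exists and is larger than `u`. -/
def headAbove (u : ℕ) (w : List ℕ) : Bool := w.head?.any (u < ·)

/-- The number of ascents of a word that straddle `u`. -/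
def crossings (u : ℕ) : List ℕ → ℕ
  | [] => 0
  | x :: w => (if x < u ∧ headAbove u w then 1 else 0) + crossings u w

/-- The number of descents straddling `u` on its left. -/
def leftStraddle (u : ℕ) (w : List ℕ) : ℕ := crossings u (before u w).reverse

/-- The number of ascents straddling `u` on its right. -/
def rightStraddle (u : ℕ) (w : List ℕ) : ℕ := crossings u (after u w)

/-- The letter before `u` exists and is larger. -/
def predAbove (u : ℕ) (w : List ℕ) : Bool := headAbove u (before u w).reverse

/-- The letter after `u` exists and is larger. -/
def succAbove (u : ℕ) (w : List ℕ) : Bool := headAbove u (after u w)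

theorem before_append_cons {u : ℕ} {l : List ℕ} (h : u ∉ l) (r : List ℕ) :
    before u (l ++ u :: r) = l := by
  induction l with
  | nil => simp [before]
  | cons x l ih =>
    rw [List.mem_cons, not_or] at h
    simp [before, Ne.symm h.1, ih h.2]

theorem after_append_cons {u : ℕ} {l : List ℕ} (h : u ∉ l) (r : List ℕ) :
    after u (l ++ u :: r) = r := by
  induction l with
  | nil => simp [after]
  | cons x l ih =>
    rw [List.mem_cons, not_or] at h
    simp [after, Ne.symm h.1, ih h.2]

theorem before_append_of_mem {u : ℕ} {l : List ℕ} (h : u ∈ l) (r : List ℕ) :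
    before u (l ++ r) = before u l := by
  induction l with
  | nil => simp at h
  | cons x l ih => grind [before]

theorem after_append_of_mem {u : ℕ} {l : List ℕ} (h : u ∈ l) (r : List ℕ) :
    after u (l ++ r) = after u l ++ r := by
  induction l with
  | nil => simp at h
  | cons x l ih => grind [after]

theorem before_append_of_notMem {u : ℕ} {l : List ℕ} (h : u ∉ l) (r : List ℕ) :
    before u (l ++ r) = l ++ before u r := by
  induction l with
  | nil => simp
  | cons x l ih => grind [before]

theorem after_append_of_notMem {u : ℕ} {l : List ℕ} (h : u ∉ l) (r : List ℕ) :
    after u (l ++ r) = after u r := by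
  induction l with
  | nil => simp
  | cons x l ih => grind [after]

section Replace

variable {u : ℕ} {B B' : List ℕ}

theorem headAbove_replace (hB : B ≠ []) (hB' : B' ≠ []) (h : ∀ x ∈ B, u < x)
    (h' : ∀ x ∈ B', u < x) (l r : List ℕ) :
    headAbove u (l ++ B ++ r) = headAbove u (l ++ B' ++ r) := by
  cases l with
  | nil => cases B <;> cases B' <;> simp_all [headAbove]
  | cons x l => simp [headAbove]

theorem crossings_append_of_forall_lt (h : ∀ x ∈ B, u < x) (r : List ℕ) :
    crossings u (B ++ r) = crossings u r := by
  induction B with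
  | nil => simp
  | cons x B ih =>
    have := h x (by simp)
    rw [List.cons_append, crossings, if_neg (by omega), ih fun y hy => h y (by simp [hy])]
    simp

theorem crossings_replace (hB : B ≠ []) (hB' : B' ≠ []) (h : ∀ x ∈ B, u < x)
    (h' : ∀ x ∈ B', u < x) (l r : List ℕ) :
    crossings u (l ++ B ++ r) = crossings u (l ++ B' ++ r) := by
  induction l with
  | nil =>
    rw [List.nil_append, List.nil_append, crossings_append_of_forall_lt h,
      crossings_append_of_forall_lt h']
  | cons x l ih =>
    simp only [List.cons_append, crossings]
    rw [ih, headAbove_replace hB hB' h h']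

/-- A statistic that only depends on the part of a word before `u` up to replacing a factor of
letters larger than `u` by another one is unchanged by such a replacement. -/
theorem before_replace {α : Type*} (F : List ℕ → α)
    (hF : ∀ l r, F (l ++ B ++ r) = F (l ++ B' ++ r))
    (h : ∀ x ∈ B, u < x) (h' : ∀ x ∈ B', u < x) (l r : List ℕ) :
    F (before u (l ++ B ++ r)) = F (before u (l ++ B' ++ r)) := by
  have hu : u ∉ B := fun hu => (h u hu).false
  have hu' : u ∉ B' := fun hu => (h' u hu).false
  by_cases hl : u ∈ l
  · rw [List.append_assoc, List.append_assoc, before_append_of_mem hl, before_append_of_mem hl]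
  · rw [before_append_of_notMem (by simp [hl, hu]), before_append_of_notMem (by simp [hl, hu']),
      hF]

theorem after_replace {α : Type*} (F : List ℕ → α)
    (hF : ∀ l r, F (l ++ B ++ r) = F (l ++ B' ++ r))
    (h : ∀ x ∈ B, u < x) (h' : ∀ x ∈ B', u < x) (l r : List ℕ) :
    F (after u (l ++ B ++ r)) = F (after u (l ++ B' ++ r)) := by
  have hu : u ∉ B := fun hu => (h u hu).false
  have hu' : u ∉ B' := fun hu => (h' u hu).false
  by_cases hl : u ∈ l
  · rw [List.append_assoc, List.append_assoc, after_append_of_mem hl, after_append_of_mem hl,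
      ← List.append_assoc, ← List.append_assoc, hF]
  · rw [after_append_of_notMem (by simp [hl, hu]), after_append_of_notMem (by simp [hl, hu'])]

/-- Only comparisons with `u` matter. A nonempty block of letters above `u` contributes no inner
crossing and looks the same from outside as any other such block, so filling a gap leaves the
statistics of smaller letters fixed. -/
theorem stats_replace (hB : B ≠ []) (hB' : B' ≠ []) (h : ∀ x ∈ B, u < x)
    (h' : ∀ x ∈ B', u < x) (l r : List ℕ) :
    leftStraddle u (l ++ B ++ r) = leftStraddle u (l ++ B' ++ r) ∧
    rightStraddle u (l ++ B ++ r) = rightStraddle u (l ++ B' ++ r) ∧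
    predAbove u (l ++ B ++ r) = predAbove u (l ++ B' ++ r) ∧
    succAbove u (l ++ B ++ r) = succAbove u (l ++ B' ++ r) := by
  refine ⟨before_replace (fun w => crossings u w.reverse) (fun l r => ?_) h h' l r,
    after_replace (crossings u) (crossings_replace hB hB' h h') h h' l r,
    before_replace (fun w => headAbove u w.reverse) (fun l r => ?_) h h' l r,
    after_replace (headAbove u) (headAbove_replace hB hB' h h') h h' l r⟩
  · have := crossings_replace (B := B.reverse) (B' := B'.reverse) (u := u) (by simpa)
      (by simpa) (by simpa) (by simpa) r.reverse l.reverse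
    simpa using this
  · have := headAbove_replace (B := B.reverse) (B' := B'.reverse) (u := u) (by simpa)
      (by simpa) (by simpa) (by simpa) r.reverse l.reverse
    simpa using this

end Replace

/-- Placeholders are the only letters above `v` and are never adjacent, so each one in `r` follows a
smaller letter and closes exactly one crossing. -/
theorem crossings_eq_count {M v : ℕ} (hv : v < M) {x : ℕ} {r : List ℕ}
    (hr : ∀ y ∈ r, y < v ∨ y = M) (hx : x < v ∨ x = M) (hc : (x :: r).IsChain (NotBoth M)) :
    crossings v (x :: r) = r.count M := by
  induction r generalizing x with
  | nil => simp [crossings, headAbove]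
  | cons y r ih =>
    rw [List.isChain_cons_cons] at hc
    have hy := hr y (by simp)
    rw [crossings, ih (fun z hz => hr z (by simp [hz])) hy hc.2, List.count_cons]
    have h1 := hc.1
    simp only [NotBoth] at h1
    simp only [headAbove, List.head?_cons, Option.any_some, decide_eq_true_eq, beq_iff_eq]
    rw [add_comm]
    congr 1
    exact if_congr (by omega) rfl rfl

theorem crossings_pad {M v : ℕ} (hv : v < M) {r : List ℕ}
    (hr : ∀ y ∈ r, y < v ∨ y = M) (hc : (M :: r).IsChain (NotBoth M)) (c : Bool) :
    crossings v (pad M c ++ r) = r.count M := by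
  rw [crossings_append_of_forall_lt, ← crossings_eq_count hv hr (Or.inr rfl) hc, crossings,
    if_neg (by omega), zero_add]
  cases c <;> simp [pad, hv]

theorem headAbove_pad {M v : ℕ} (hv : v < M) {r : List ℕ}
    (hr : ∀ y ∈ r, y < v ∨ y = M) (hc : (M :: r).IsChain (NotBoth M)) (c : Bool) :
    headAbove v (pad M c ++ r) = c := by
  cases c
  · cases r with
    | nil => simp [headAbove, pad]
    | cons y r =>
      have h1 := (List.isChain_cons_cons.1 hc).1
      have h2 := hr y (by simp)
      have h3 : y ≠ M := fun e => h1 ⟨rfl, e⟩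
      simp [headAbove, pad]
      omega
  · simp [headAbove, pad, hv]

/-- A gap kept right next to v + 1 is not counted: no smaller letter separates it from v + 1. Only
the gaps in `l` and `r` produce straddles. -/
theorem stats_fillGap {M v : ℕ} (hv : v + 1 < M) {l r : List ℕ}
    (h : IsGapWord M v (l ++ M :: r)) (b c : Bool) :
    leftStraddle (v + 1) (fillGap M (v + 1) l r b c) = l.count M ∧
    rightStraddle (v + 1) (fillGap M (v + 1) l r b c) = r.count M ∧
    predAbove (v + 1) (fillGap M (v + 1) l r b c) = b ∧
    succAbove (v + 1) (fillGap M (v + 1) l r b c) = c := by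
  have hn := (h.notMem hv.ne).1 b
  have hc := List.isChain_split.1 h.1
  have hl : ∀ y ∈ l.reverse, y < v + 1 ∨ y = M := fun y hy => by
    have := h.mem (x := y) (by simp_all); omega
  have hr : ∀ y ∈ r, y < v + 1 ∨ y = M := fun y hy => by
    have := h.mem (x := y) (by simp_all); omega
  have hc1 : (M :: l.reverse).IsChain (NotBoth M) := by
    have : (l ++ [M]).reverse.IsChain (NotBoth M) :=
      List.isChain_reverse.2 (hc.1.imp fun a b h h' => h h'.symm)
    simpa using this
  have hp : (l ++ pad M b).reverse = pad M b ++ l.reverse := by cases b <;> simp [pad]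
  rw [leftStraddle, rightStraddle, predAbove, succAbove, fillGap, before_append_cons hn,
    after_append_cons hn, hp, crossings_pad hv hl hc1, crossings_pad hv hr hc.2,
    headAbove_pad hv hl hc1, headAbove_pad hv hr hc.2]
  simp

/-! ### The recursion on the number of gaps -/

section Transfer

variable {R : Type*} [CommRing R]

/-- The weight of the letter `u` in a word, as a function of `u`, of whether `u - 1` comes after
a larger letter, of the numbers of descents on the left and of ascents on the right that straddle
`u`, and of whether the neighbours of `u` are larger. -/
def letterWeight (f : ℕ → Bool → ℕ → ℕ → Bool → Bool → R) (u : ℕ) (w : List ℕ) : R :=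
  f u (predAbove (u - 1) w) (leftStraddle u w) (rightStraddle u w) (predAbove u w) (succAbove u w)

/-- The total weight of the ways to insert `m` more letters, the first one being `v + 1`, in `K`
gaps so that no gap remains. -/
def transfer (f : ℕ → Bool → ℕ → ℕ → Bool → Bool → R) : ℕ → ℕ → Bool → ℕ → R
  | 0, _, _, K => if K = 0 then 1 else 0
  | m + 1, v, d, K => ∑ i ∈ range K,
      (f (v + 1) d i (K - 1 - i) false false * transfer f m (v + 1) false (K - 1) +
        f (v + 1) d i (K - 1 - i) false true * transfer f m (v + 1) false K +
        f (v + 1) d i (K - 1 - i) true false * transfer f m (v + 1) true K +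
        f (v + 1) d i (K - 1 - i) true true * transfer f m (v + 1) true (K + 1))

/-- The factors of the old letters are unchanged by `stats_replace`, and the new factor depends only
on the chosen gap, the two Booleans and the flag of `v` in the old word. -/
theorem letterWeight_fillGap (f : ℕ → Bool → ℕ → ℕ → Bool → Bool → R) {M v : ℕ} (hv : v + 1 < M)
    {l r : List ℕ} (h : IsGapWord M v (l ++ M :: r)) (b c : Bool) :
    (∏ u ∈ Icc 1 (v + 1), letterWeight f u (fillGap M (v + 1) l r b c)) =
      (∏ u ∈ Icc 1 v, letterWeight f u (l ++ M :: r)) *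
        f (v + 1) (predAbove v (l ++ M :: r)) (l.count M) (r.count M) b c := by
  have key : ∀ u ≤ v, leftStraddle u (fillGap M (v + 1) l r b c) = leftStraddle u (l ++ M :: r) ∧
      rightStraddle u (fillGap M (v + 1) l r b c) = rightStraddle u (l ++ M :: r) ∧
      predAbove u (fillGap M (v + 1) l r b c) = predAbove u (l ++ M :: r) ∧
      succAbove u (fillGap M (v + 1) l r b c) = succAbove u (l ++ M :: r) := by
    intro u hu
    have := stats_replace (u := u) (B := pad M b ++ (v + 1) :: pad M c) (B' := [M])
      (by simp) (by simp) ?_ (by simp; omega) l r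
    · simpa [fillGap] using this
    · intro x hx
      cases b <;> cases c <;> simp [pad] at hx <;> omega
  rw [prod_Icc_succ_top (by omega)]
  congr 1
  · refine prod_congr rfl fun u hu => ?_
    rw [mem_Icc] at hu
    obtain ⟨h1, h2, h3, h4⟩ := key u hu.2
    rw [letterWeight, letterWeight, h1, h2, h3, h4, (key (u - 1) (by omega)).2.2.1]
  · obtain ⟨h1, h2, h3, h4⟩ := stats_fillGap hv h b c
    rw [letterWeight, h1, h2, h3, h4, Nat.add_sub_cancel, (key v le_rfl).2.2.1]

/-- The weighted sum of the words at a level, each completed in all possible ways. -/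
def levelSum (f : ℕ → Bool → ℕ → ℕ → Bool → Bool → R) (M v m : ℕ) : R :=
  ((gapWords M v).map fun w =>
    (∏ u ∈ Icc 1 v, letterWeight f u w) * transfer f m v (predAbove v w) (w.count M)).sum

theorem count_fillGap {M v : ℕ} (hv : v ≠ M) (l r : List ℕ) (b c : Bool) :
    (fillGap M v l r b c).count M = l.count M + r.count M + b.toNat + c.toNat := by
  cases b <;> cases c <;> simp [fillGap, pad, hv] <;> omega

theorem sum_map_flatMap {α β : Type*} (s : List α) (g : α → List β) (h : β → R) :
    ((s.flatMap g).map h).sum = (s.map fun a => ((g a).map h).sum).sum := by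
  induction s with
  | nil => simp
  | cons a s ih => simp [ih]

/-- One step of `transfer` lists the choices of a gap and of the two Booleans, which are exactly the
children of a gap word. Thus the total is conserved from level to level. -/
theorem levelSum_succ (f : ℕ → Bool → ℕ → ℕ → Bool → Bool → R) {M v : ℕ} (hv : v + 1 < M)
    (m : ℕ) : levelSum f M (v + 1) m = levelSum f M v (m + 1) := by
  simp only [levelSum, gapWords, sum_map_flatMap]
  congr 1
  refine List.map_congr_left fun w hw => ?_
  rw [mem_gapWords (by omega)] at hw
  rw [transfer, ← sum_splits M w fun i j =>
    f (v + 1) (predAbove v w) i j false false * transfer f m (v + 1) false (w.count M - 1) +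
      f (v + 1) (predAbove v w) i j false true * transfer f m (v + 1) false (w.count M) +
      f (v + 1) (predAbove v w) i j true false * transfer f m (v + 1) true (w.count M) +
      f (v + 1) (predAbove v w) i j true true * transfer f m (v + 1) true (w.count M + 1),
    ← List.sum_map_mul_left]
  congr 1
  refine List.map_congr_left fun z hz => ?_
  obtain ⟨l, r⟩ := z
  rw [mem_splits] at hz
  subst hz
  simp only [fillings, List.map_cons, List.map_nil, List.sum_cons, List.sum_nil,
    letterWeight_fillGap f hv hw, (stats_fillGap hv hw _ _).2.2.1, count_fillGap hv.ne,
    List.count_append, List.count_cons_self, Bool.toNat_false, Bool.toNat_true]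
  simp only [add_zero, ← add_assoc, Nat.add_sub_cancel]
  ring

/-- Level 0 has the single word `[M]`, which gives the left side; at level N the remaining transfer
factor keeps only the words without gaps. -/
theorem transfer_eq_sum (f : ℕ → Bool → ℕ → ℕ → Bool → Bool → R) {M N : ℕ} (hN : N < M) :
    transfer f N 0 (predAbove 0 [M]) 1 =
      ((gapWords M N).map fun w =>
        if w.count M = 0 then ∏ u ∈ Icc 1 N, letterWeight f u w else 0).sum := by
  have key : ∀ v ≤ N, levelSum f M v (N - v) = levelSum f M 0 N := by
    intro v hv
    induction v with
    | zero => simp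
    | succ v ih =>
      rw [levelSum_succ f (by omega), ← ih (by omega)]
      congr 1
      omega
  have := key N le_rfl
  rw [Nat.sub_self] at this
  calc _ = levelSum f M 0 N := by simp [levelSum, gapWords]
    _ = _ := this.symm
    _ = _ := by simp [levelSum, transfer]

/-- The sum over all permutations of `1, …, N` of the products of their letter weights. -/
theorem sum_permutations_eq_transfer (f : ℕ → Bool → ℕ → ℕ → Bool → Bool → R) {N : ℕ} (hN : 0 < N) :
    ∑ w ∈ (List.range' 1 N).permutations.toFinset, ∏ u ∈ Icc 1 N, letterWeight f u w =
      transfer f N 0 (predAbove 0 [N + 1]) 1 := by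
  rw [transfer_eq_sum f (Nat.lt_succ_self N), ← List.sum_toFinset _
    (nodup_gapWords (Nat.lt_succ_self N)), ← sum_filter]
  refine sum_congr ?_ fun _ _ => rfl
  ext w
  simp only [List.mem_toFinset, List.mem_permutations, mem_filter,
    mem_gapWords (Nat.lt_succ_self N), List.count_eq_zero]
  constructor
  · intro h
    have hM : N + 1 ∉ w := fun hm => by
      have := h.mem_iff.1 hm
      rw [List.mem_range'_1] at this
      omega
    have hne : ∀ x ∈ w, x ≠ N + 1 := fun x hx e => hM (e ▸ hx)
    refine ⟨⟨?_, ?_, ?_⟩, hM⟩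
    · exact (List.isChain_isInfix w).imp fun x y hxy hb => hne x (hxy.subset (by simp)) hb.1
    · rwa [List.filter_eq_self.2 (by simpa using hne)]
    · rintro rfl
      have := h.length_eq
      simp at this
      omega
  · rintro ⟨h, hM⟩
    have hne : ∀ x ∈ w, x ≠ N + 1 := fun x hx e => hM (by rwa [e] at hx)
    have := h.2.1
    rwa [List.filter_eq_self.2 (by simpa using hne)] at this

end Transfer

/-! ### The two weights and the equality of their transfers -/

section Weights

variable {R : Type*} [CommRing R]

/-- The letter weights whose products are the terms of `polyX n a 1 1 1 p q y t`, once `2n + 1` is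
appended to the permutations. -/
def weightX (n : ℕ) (a p q y t : R) (v : ℕ) (d : Bool) (i j : ℕ) (b c : Bool) : R :=
  if v = 2 * n + 1 then 1
  else if Odd v then if c then q ^ i * p ^ j * (if b then t else 1) else 0
  else if b then 0
  else (if i = 0 then a else 1) * q ^ i *
    if c then p ^ j else if j = 0 then 0 else p ^ (j - 1) * (if d then y else 1)

/-- The letter weights whose products are the terms of `polyY n a p q y t`. -/
def weightY (a p q y t : R) (v : ℕ) (_ : Bool) (i j : ℕ) (b c : Bool) : R :=
  if Odd v then q ^ i * p ^ j * (if b then t else 1) * (if b ∧ ¬c then y else 1)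
  else if b ∨ ¬c then 0
  else (if i = 0 then a else 1) * q ^ i * p ^ j

/-- The `(p, q)`-analogue of `K`. -/
def pqNumber (p q : R) (K : ℕ) : R := ∑ i ∈ range K, q ^ i * p ^ (K - 1 - i)

/-- The `(p, q)`-analogue of `K` with its first term multiplied by `a`. -/
def pqNumberFirst (a p q : R) (K : ℕ) : R :=
  ∑ i ∈ range K, (if i = 0 then a else 1) * q ^ i * p ^ (K - 1 - i)

/-- An odd letter is not a descent top, so the gap on its right stays. A gap on its left makes it a
descent bottom and contributes t. -/
theorem transfer_weightX_odd {n : ℕ} (a p q y t : R) {m v : ℕ} (hv : Odd (v + 1))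
    (hn : v + 1 ≠ 2 * n + 1) (d : Bool) (K : ℕ) :
    transfer (weightX n a p q y t) (m + 1) v d K = pqNumber p q K *
      (transfer (weightX n a p q y t) m (v + 1) false K +
        t * transfer (weightX n a p q y t) m (v + 1) true (K + 1)) := by
  rw [transfer, pqNumber, sum_mul]
  refine sum_congr rfl fun i _ => ?_
  simp only [weightX, if_neg hn, if_pos hv]
  simp
  ring

/-- An even letter is not a descent bottom, so no gap stays on its left. If it is a descent top, its
gap disappears; the rightmost gap is then forbidden and the exponent of p drops by 1, whence the
index K - 1. -/
theorem transfer_weightX_even {n : ℕ} (a p q y t : R) {m v : ℕ} (hv : Even (v + 1))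
    (d : Bool) (K : ℕ) :
    transfer (weightX n a p q y t) (m + 1) v d K =
      pqNumberFirst a p q K * transfer (weightX n a p q y t) m (v + 1) false K +
      pqNumberFirst a p q (K - 1) * ((if d then y else 1) *
        transfer (weightX n a p q y t) m (v + 1) false (K - 1)) := by
  have hn : v + 1 ≠ 2 * n + 1 := by
    rintro h
    rw [h] at hv
    exact (Nat.not_even_iff_odd.2 ⟨n, rfl⟩) hv
  have ho : ¬Odd (v + 1) := Nat.not_odd_iff_even.2 hv
  cases K with
  | zero => simp [transfer, pqNumberFirst]
  | succ K =>
    -- The split-off term is the rightmost gap, where j = 0 and a descent top has weight 0.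
    rw [transfer, pqNumberFirst, pqNumberFirst, sum_mul, sum_mul, Nat.add_sub_cancel,
      sum_range_succ, sum_range_succ]
    conv_rhs => rw [add_right_comm, ← sum_add_distrib]
    simp only [weightX, if_neg hn, if_neg ho]
    congr 1
    · refine sum_congr rfl fun i hi => ?_
      rw [mem_range] at hi
      have h1 : K - i ≠ 0 := by omega
      have h2 : K - i - 1 = K - 1 - i := by omega
      simp [h1, h2]
      split_ifs <;> ring
    · simp

theorem transfer_weightY_odd (a p q y t : R) {m v : ℕ} (hv : Odd (v + 1)) (d : Bool) (K : ℕ) :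
    transfer (weightY a p q y t) (m + 1) v d K = pqNumber p q K *
      (transfer (weightY a p q y t) m (v + 1) false (K - 1) +
        transfer (weightY a p q y t) m (v + 1) false K +
        t * y * transfer (weightY a p q y t) m (v + 1) true K +
        t * transfer (weightY a p q y t) m (v + 1) true (K + 1)) := by
  rw [transfer, pqNumber, sum_mul]
  refine sum_congr rfl fun i _ => ?_
  simp only [weightY, if_pos hv]
  simp
  ring

theorem transfer_weightY_even (a p q y t : R) {m v : ℕ} (hv : Even (v + 1)) (d : Bool) (K : ℕ) :
    transfer (weightY a p q y t) (m + 1) v d K =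
      pqNumberFirst a p q K * transfer (weightY a p q y t) m (v + 1) false K := by
  have ho : ¬Odd (v + 1) := Nat.not_odd_iff_even.2 hv
  rw [transfer, pqNumberFirst, sum_mul]
  refine sum_congr rfl fun i _ => ?_
  simp [weightY, if_neg ho]

/-- The induction removes two letters, odd then even. The flags are arbitrary because the first
letter treated is odd, and odd letters ignore them. -/
theorem transfer_weightX_eq_weightY (n : ℕ) (a p q y t : R) {k v : ℕ} (hv : v + 2 * k = 2 * n)
    (d d' : Bool) (K : ℕ) :
    transfer (weightX n a p q y t) (2 * k + 1) v d K =
      transfer (weightY a p q y t) (2 * k + 1) v d' K := by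
  induction k generalizing v d d' K with
  | zero =>
    have hv' : v = 2 * n := by omega
    subst hv'
    have ho : Odd (2 * n + 1) := ⟨n, rfl⟩
    simp only [transfer]
    -- A single letter can close all gaps only if there is exactly one; both weights are then 1.
    rcases K with _ | _ | K
    · simp
    · simp [weightX, weightY]
    · simp
  | succ k ih =>
    have hev : Even v := ⟨n - (k + 1), by omega⟩
    have h1 : Odd (v + 1) := hev.add_one
    have h2 : Even (v + 1 + 1) := h1.add_one
    rw [show 2 * (k + 1) + 1 = (2 * k + 1) + 1 + 1 by ring,
      transfer_weightX_odd a p q y t h1 (by omega), transfer_weightY_odd a p q y t h1]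
    simp only [transfer_weightX_even a p q y t h2, transfer_weightY_even a p q y t h2,
      Nat.add_sub_cancel]
    have := fun K => ih (v := v + 1 + 1) (by omega) false false K
    simp only [this]
    simp
    ring

end Weights

/-! ### The letter statistics in one-line notation -/

theorem crossings_map_range' (u : ℕ) (e : ℕ → ℕ) (s m : ℕ) :
    crossings u ((List.range' s m).map e) =
      #{i ∈ Ico s (s + m - 1) | e i < u ∧ u < e (i + 1)} := by
  induction m generalizing s with
  | zero => simp [crossings]
  | succ m ih =>
    rw [List.range'_succ, List.map_cons, crossings, ih]
    cases m with
    | zero => simp [headAbove]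
    | succ m =>
      rw [show s + (m + 1 + 1) - 1 = s + 1 + m by omega,
        show s + 1 + (m + 1) - 1 = s + 1 + m by omega, List.range'_succ,
        ← insert_Ico_add_one_left_eq_Ico (a := s) (b := s + 1 + m) (by omega), filter_insert]
      simp only [headAbove, List.map_cons, List.head?_cons, Option.any_some, decide_eq_true_eq]
      split_ifs
      · rw [card_insert_of_notMem (by simp), add_comm]
      · simp

theorem crossings_reverse_map_range' (u : ℕ) (e : ℕ → ℕ) (s m : ℕ) :
    crossings u ((List.range' s m).map e).reverse =
      #{i ∈ Ico s (s + m - 1) | u < e i ∧ e (i + 1) < u} := by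
  induction m with
  | zero => simp [crossings]
  | succ m ih =>
    rw [List.range'_concat, List.map_append, List.map_singleton, List.reverse_append,
      List.reverse_singleton, List.singleton_append, crossings, ih, one_mul]
    cases m with
    | zero => simp [headAbove]
    | succ m =>
      rw [show s + (m + 1 + 1) - 1 = s + m + 1 by omega,
        show s + (m + 1) - 1 = s + m by omega, List.range'_concat,
        ← insert_Ico_right_eq_Ico_add_one (a := s) (b := s + m) (by omega), filter_insert]
      simp only [headAbove, List.map_append, List.reverse_append, List.map_cons, List.map_nil,
        List.reverse_singleton, List.singleton_append, List.head?_cons, Option.any_some,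
        decide_eq_true_eq, one_mul, ← add_assoc, and_comm]
      split_ifs
      · rw [card_insert_of_notMem (by simp), add_comm]
      · simp

section Stats

variable {e : ℕ → ℕ} {N k : ℕ}

theorem map_range'_eq_append (hk : k ∈ Icc 1 N) :
    (List.range' 1 N).map e =
      (List.range' 1 (k - 1)).map e ++ e k :: (List.range' (k + 1) (N - k)).map e := by
  rw [mem_Icc] at hk
  rw [← List.map_cons, ← List.map_append, ← List.range'_succ]
  congr 1
  have := List.range'_append (s := 1) (m := k - 1) (n := N - k + 1) (step := 1)
  rw [show 1 + 1 * (k - 1) = k by omega, show k - 1 + (N - k + 1) = N by omega] at this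
  exact this.symm

theorem notMem_map_range' (he : Set.InjOn e (Icc 1 N)) (hk : k ∈ Icc 1 N) :
    e k ∉ (List.range' 1 (k - 1)).map e := by
  rw [mem_Icc] at hk
  simp only [List.mem_map, List.mem_range'_1, not_exists, not_and]
  intro i hi h
  have := he (by simp; omega) (by simp; omega) h
  omega

theorem leftStraddle_map_range' (he : Set.InjOn e (Icc 1 N)) (hk : k ∈ Icc 1 N) :
    leftStraddle (e k) ((List.range' 1 N).map e) =
      #{i ∈ Ico 1 (k - 1) | e k < e i ∧ e (i + 1) < e k} := by
  rw [leftStraddle, map_range'_eq_append hk, before_append_cons (notMem_map_range' he hk),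
    crossings_reverse_map_range', show 1 + (k - 1) - 1 = k - 1 by omega]

theorem rightStraddle_map_range' (he : Set.InjOn e (Icc 1 N)) (hk : k ∈ Icc 1 N) :
    rightStraddle (e k) ((List.range' 1 N).map e) =
      #{i ∈ Ico (k + 1) N | e i < e k ∧ e k < e (i + 1)} := by
  rw [rightStraddle, map_range'_eq_append hk, after_append_cons (notMem_map_range' he hk),
    crossings_map_range']
  rw [mem_Icc] at hk
  rw [show k + 1 + (N - k) - 1 = N by omega]

theorem predAbove_map_range' (he : Set.InjOn e (Icc 1 N)) (hk : k ∈ Icc 1 N) :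
    predAbove (e k) ((List.range' 1 N).map e) = decide (2 ≤ k ∧ e k < e (k - 1)) := by
  rw [predAbove, map_range'_eq_append hk, before_append_cons (notMem_map_range' he hk)]
  rw [mem_Icc] at hk
  obtain rfl | ⟨m, rfl⟩ : k = 1 ∨ ∃ m, k = m + 2 := by
    rcases k with _ | _ | m
    · omega
    · exact Or.inl rfl
    · exact Or.inr ⟨m, rfl⟩
  · simp [headAbove]
  · rw [show m + 2 - 1 = m + 1 by omega, List.range'_concat]
    simp [headAbove, add_comm]

theorem succAbove_map_range' (he : Set.InjOn e (Icc 1 N)) (hk : k ∈ Icc 1 N) :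
    succAbove (e k) ((List.range' 1 N).map e) = decide (k < N ∧ e k < e (k + 1)) := by
  rw [succAbove, map_range'_eq_append hk, after_append_cons (notMem_map_range' he hk)]
  rw [mem_Icc] at hk
  obtain rfl | ⟨m, hm⟩ : k = N ∨ ∃ m, N - k = m + 1 := by
    rcases h : N - k with _ | m
    · left; omega
    · exact Or.inr ⟨m, rfl⟩
  · simp [headAbove]
  · rw [hm, List.range'_succ]
    simp [headAbove, show k < N by omega]

/-- An entry that is preceded by a smaller one and straddled by no descent on its left exceeds all
entries on its left. -/
theorem forall_lt_iff_straddle (he : Set.InjOn e (Icc 1 N)) (hk : k ∈ Icc 1 N) :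
    (∀ j ∈ Ico 1 k, e j < e k) ↔
      #{i ∈ Ico 1 (k - 1) | e k < e i ∧ e (i + 1) < e k} = 0 ∧ ¬(2 ≤ k ∧ e k < e (k - 1)) := by
  rw [mem_Icc] at hk
  simp only [card_eq_zero, filter_eq_empty_iff, mem_Ico]
  constructor
  · intro h
    refine ⟨fun i hi h' => ?_, fun h' => ?_⟩
    · have := h i (by omega)
      omega
    · have := h (k - 1) (by omega)
      omega
  · rintro ⟨h1, h2⟩
    -- Induction leftwards from position k - 1: the first entry above `e k` met on the way would
    -- begin a straddling descent.
    have key : ∀ m, ∀ j, j + m + 1 = k → 1 ≤ j → e j < e k := by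
      intro m
      induction m with
      | zero =>
        intro j hj hj1
        have hne : e j ≠ e k := fun h => by
          have := he (by simp; omega) (by simp; omega) h
          omega
        have : ¬ e k < e j := fun h => h2 ⟨by omega, by rwa [show k - 1 = j by omega]⟩
        omega
      | succ m ih =>
        intro j hj hj1
        have hne : e j ≠ e k := fun h => by
          have := he (by simp; omega) (by simp; omega) h
          omega
        have := ih (j + 1) (by omega) (by omega)
        have h3 := @h1 j (by omega)
        omega
    intro j hj
    exact key (k - j - 1) j (by omega) hj.1

end Stats

/-! ### Permutations and their words -/

section Words

variable {N : ℕ}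

theorem entry_of_mem (σ : Equiv.Perm (Fin N)) {k : ℕ} (hk : k < N) :
    entry σ (k + 1) = σ ⟨k, hk⟩ + 1 := by
  rw [entry, dif_pos (by omega)]
  rfl

theorem entry_mem (σ : Equiv.Perm (Fin N)) {k : ℕ} (hk : k ∈ Icc 1 N) :
    entry σ k ∈ Icc 1 N := by
  rw [mem_Icc] at *
  rw [entry, dif_pos hk]
  have := (σ ⟨k - 1, by omega⟩).2
  omega

theorem injOn_entry (σ : Equiv.Perm (Fin N)) : Set.InjOn (entry σ) (Icc 1 N) := by
  intro i hi j hj h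
  rw [mem_coe, mem_Icc] at hi hj
  rw [entry, entry, dif_pos hi, dif_pos hj, Nat.add_right_cancel_iff, Fin.val_inj,
    σ.injective.eq_iff, Fin.mk.injEq] at h
  omega

theorem perm_of_injOn {e : ℕ → ℕ} (he : Set.InjOn e (Icc 1 N)) (hm : ∀ k ∈ Icc 1 N, e k ∈ Icc 1 N) :
    ((List.range' 1 N).map e).Perm (List.range' 1 N) := by
  have hnd : ((List.range' 1 N).map e).Nodup := by
    refine List.Nodup.map_on ?_ (List.nodup_range' ..)
    intro x hx y hy h
    rw [List.mem_range'_1] at hx hy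
    exact he (by simp; omega) (by simp; omega) h
  refine (List.subperm_of_subset hnd ?_).perm_of_length_le (by simp)
  intro x hx
  obtain ⟨k, hk, rfl⟩ := List.mem_map.1 hx
  rw [List.mem_range'_1] at hk ⊢
  have := hm k (by simp; omega)
  rw [mem_Icc] at this
  omega

theorem exists_map_entry_eq {w : List ℕ} (hw : w.Perm (List.range' 1 N)) :
    ∃ σ : Equiv.Perm (Fin N), (List.range' 1 N).map (entry σ) = w := by
  have hl : w.length = N := by simpa using hw.length_eq
  have hnd : w.Nodup := hw.nodup_iff.2 (List.nodup_range' ..)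
  have hmem : ∀ i (hi : i < w.length), 1 ≤ w[i] ∧ w[i] < 1 + N := fun i hi => by
    have := hw.mem_iff.1 (w.getElem_mem hi)
    rwa [List.mem_range'_1] at this
  let g : Fin N → Fin N := fun i => ⟨w[i.1]'(by omega) - 1, by have := hmem i (by omega); omega⟩
  have hg : Function.Injective g := by
    intro i j h
    have h1 := hmem i (by omega)
    have h2 := hmem j (by omega)
    have h3 : w[i.1]'(by omega) = w[j.1]'(by omega) := by
      have := congrArg Fin.val h
      simp only [g] at this
      omega
    have := (hnd.getElem_inj_iff).1 h3
    exact Fin.ext this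
  refine ⟨Equiv.ofBijective g (Finite.injective_iff_bijective.1 hg), ?_⟩
  refine List.ext_getElem (by simp [hl]) fun i h1 h2 => ?_
  have h3 := hmem i h2
  have hi : i < N := by omega
  rw [List.getElem_map, List.getElem_range', one_mul, add_comm, entry_of_mem _ hi]
  simp only [Equiv.ofBijective_apply, g]
  omega

theorem perm_ext_of_entry {σ τ : Equiv.Perm (Fin N)}
    (h : ∀ k ∈ Icc 1 N, entry σ k = entry τ k) : σ = τ := by
  ext i
  have := h (i + 1) (by simp)
  rw [entry_of_mem _ i.2, entry_of_mem _ i.2] at this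
  exact Nat.add_right_cancel this

theorem prod_Icc_eq_prod_comp {R : Type*} [CommRing R] {e : ℕ → ℕ}
    (he : Set.InjOn e (Icc 1 N)) (hm : ∀ k ∈ Icc 1 N, e k ∈ Icc 1 N) (G : ℕ → R) :
    ∏ u ∈ Icc 1 N, G u = ∏ k ∈ Icc 1 N, G (e k) := by
  have him : (Icc 1 N).image e = Icc 1 N := by
    refine eq_of_subset_of_card_le (image_subset_iff.2 hm) ?_
    rw [card_image_of_injOn he]
  conv_lhs => rw [← him]
  exact prod_image he

end Words

/-! ### Global statistics as sums over letters -/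

section Counts

variable {N : ℕ}

theorem sum_leftStraddle_eq_les (σ : Equiv.Perm (Fin N)) :
    ∑ k ∈ Icc 1 N, #{i ∈ Ico 1 (k - 1) | entry σ k < entry σ i ∧ entry σ (i + 1) < entry σ k} =
      les σ := by
  rw [← card_sigma, les]
  refine card_nbij' (fun x => (x.2 + 1, x.1)) (fun x => ⟨x.2, x.1 - 1⟩) ?_ ?_ ?_ ?_
  · rintro ⟨k, i⟩ h
    simp at h ⊢
    omega
  · rintro ⟨i, k⟩ h
    simp at h ⊢
    rw [show i - 1 + 1 = i by omega]
    omega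
  · rintro ⟨k, i⟩ h
    simp
  · rintro ⟨i, k⟩ h
    simp at h ⊢
    omega

theorem sum_rightStraddle_eq_resAsc (σ : Equiv.Perm (Fin N)) :
    ∑ k ∈ Icc 1 N, #{j ∈ Ico (k + 1) N | entry σ j < entry σ k ∧ entry σ k < entry σ (j + 1)} =
      resAsc σ := by
  rw [← card_sigma, resAsc]
  refine card_nbij' (fun x => (x.1, x.2)) (fun x => ⟨x.1, x.2⟩) ?_ ?_ ?_ ?_
  · rintro ⟨k, i⟩ h
    simp at h ⊢
    omega
  · rintro ⟨i, k⟩ h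
    simp at h ⊢
    omega
  · rintro ⟨k, i⟩ h
    simp
  · rintro ⟨i, k⟩ h
    simp

theorem sum_rightStraddle_eq_resDesc (σ : Equiv.Perm (Fin N)) :
    ∑ k ∈ Icc 1 N, #{j ∈ Ico (k + 1) N | entry σ k < entry σ j ∧ entry σ (j + 1) < entry σ k} =
      resDesc σ := by
  rw [← card_sigma, resDesc]
  refine card_nbij' (fun x => (x.1, x.2)) (fun x => ⟨x.1, x.2⟩) ?_ ?_ ?_ ?_
  · rintro ⟨k, i⟩ h
    simp at h ⊢
    omega
  · rintro ⟨i, k⟩ h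
    simp at h ⊢
    omega
  · rintro ⟨k, i⟩ h
    simp
  · rintro ⟨i, k⟩ h
    simp

theorem card_predAbove_eq_des (σ : Equiv.Perm (Fin N)) :
    #{k ∈ Icc 1 N | 2 ≤ k ∧ entry σ k < entry σ (k - 1)} = des σ := by
  rw [des]
  refine card_nbij' (fun k => k - 1) (fun i => i + 1) ?_ ?_ ?_ ?_
  · intro k h
    simp [IsDescentAt] at h ⊢
    rw [show k - 1 + 1 = k by omega]
    omega
  · intro k h
    simp [IsDescentAt] at h ⊢
    omega
  · intro k h
    simp at h ⊢
    omega
  · intro k h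
    simp

theorem prod_ite_one_eq_pow {R : Type*} [CommRing R] (s : Finset ℕ) (P : ℕ → Prop)
    [DecidablePred P] (x : R) : ∏ k ∈ s, (if P k then x else 1) = x ^ #{k ∈ s | P k} := by
  rw [prod_ite]
  simp

theorem sum_perm_eq_sum_words {R : Type*} [CommRing R] (N : ℕ) (G : List ℕ → R) :
    ∑ σ : Equiv.Perm (Fin N), G ((List.range' 1 N).map (entry σ)) =
      ∑ w ∈ (List.range' 1 N).permutations.toFinset, G w := by
  refine sum_nbij (fun σ => (List.range' 1 N).map (entry σ)) ?_ ?_ ?_ fun _ _ => rfl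
  · intro σ _
    rw [List.mem_toFinset, List.mem_permutations]
    exact perm_of_injOn (injOn_entry σ) fun k hk => entry_mem σ hk
  · intro σ _ τ _ h
    refine perm_ext_of_entry fun k hk => ?_
    rw [mem_Icc] at hk
    exact List.map_inj_left.1 h k (by rw [List.mem_range'_1]; omega)
  · intro w hw
    rw [mem_coe, List.mem_toFinset, List.mem_permutations] at hw
    obtain ⟨σ, rfl⟩ := exists_map_entry_eq hw
    exact ⟨σ, by simp, rfl⟩

/-- Used to pass from permutations of `[2n]` to words of length 2n + 1: the weight of X vanishes
unless the last letter is the largest. -/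
theorem sum_words_succ {R : Type*} [CommRing R] (N : ℕ) (G : List ℕ → R)
    (hG : ∀ w x, x ≤ N → 1 ≤ x → x ∉ w → G (w ++ [x]) = 0) :
    ∑ w ∈ (List.range' 1 N).permutations.toFinset, G (w ++ [N + 1]) =
      ∑ w ∈ (List.range' 1 (N + 1)).permutations.toFinset, G w := by
  have hp : ∀ w : List ℕ, (w ++ [N + 1]).Perm (List.range' 1 (N + 1)) ↔
      w.Perm (List.range' 1 N) := fun w => by
    rw [← perm_range'_succ_iff (w := w)]
    have : (w ++ [N + 1]).Perm ((N + 1) :: w) := by simp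
    exact ⟨fun h => this.symm.trans h, fun h => this.trans h⟩
  refine sum_of_injOn (fun w => w ++ [N + 1]) ?_ ?_ ?_ fun _ _ => rfl
  · intro w _ w' _ h
    simpa using h
  · intro w hw
    rw [mem_coe, List.mem_toFinset, List.mem_permutations] at *
    exact (hp w).2 hw
  · intro w hw hn
    rw [List.mem_toFinset, List.mem_permutations] at hw
    rcases List.eq_nil_or_concat w with rfl | ⟨w', x, rfl⟩
    · simpa using hw.length_eq
    · rw [List.concat_eq_append] at *
      have hx := hw.mem_iff (a := x)
      rw [List.mem_range'_1] at hx
      have hx := hx.1 (by simp)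
      by_cases hxN : x = N + 1
      · subst hxN
        refine (hn ⟨w', ?_, rfl⟩).elim
        rw [mem_coe, List.mem_toFinset, List.mem_permutations]
        exact (hp w').1 hw
      · refine hG w' x (by omega) (by omega) ?_
        have : (w' ++ [x]).Nodup := hw.nodup_iff.2 (List.nodup_range' ..)
        rw [List.nodup_append] at this
        exact fun h => this.2.2 x h x (by simp) rfl

/-- Between a position and a later entry larger than `u`, the ascents and the descents that
straddle `u` alternate. -/
theorem card_ascents_eq_card_descents {e : ℕ → ℕ} {u : ℕ} {m s : ℕ} (hN : u < e (s + m))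
    (hne : ∀ j ∈ Icc s (s + m), e j ≠ u) :
    #{j ∈ Ico s (s + m) | e j < u ∧ u < e (j + 1)} =
      #{j ∈ Ico s (s + m) | u < e j ∧ e (j + 1) < u} + if u < e s then 0 else 1 := by
  induction m generalizing s with
  | zero =>
    rw [add_zero] at hN
    simp [hN]
  | succ m ih =>
    have h1 := ih (s := s + 1) (by rwa [show s + 1 + m = s + (m + 1) by omega])
      (fun j hj => hne j (by rw [mem_Icc] at *; omega))
    have h2 := hne s (by rw [mem_Icc]; omega)
    have h3 := hne (s + 1) (by rw [mem_Icc]; omega)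
    rw [← insert_Ico_add_one_left_eq_Ico (a := s) (b := s + (m + 1)) (by omega), filter_insert,
      filter_insert]
    rw [show s + 1 + m = s + (m + 1) by omega] at h1
    have hn1 : s ∉ {j ∈ Ico (s + 1) (s + (m + 1)) | e j < u ∧ u < e (j + 1)} := by simp
    have hn2 : s ∉ {j ∈ Ico (s + 1) (s + (m + 1)) | u < e j ∧ e (j + 1) < u} := by simp
    split_ifs at h1 ⊢ <;> (try rw [card_insert_of_notMem hn1]) <;>
      (try rw [card_insert_of_notMem hn2]) <;> omega

end Counts

/-! ### The terms of Y as products of letter weights -/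

section TermY

variable {R : Type*} [CommRing R] {n : ℕ}

/-- Membership becomes a condition on each letter, the one under which its factor in `weightY` is
not set to 0. The odd last entry ensures that an even letter has a successor. -/
theorem mem_oddOddPermsStar_iff (σ : Equiv.Perm (Fin (2 * n + 1))) :
    σ ∈ oddOddPermsStar n ↔ ∀ k ∈ Icc 1 (2 * n + 1), Odd (entry σ k) ∨
      ¬(2 ≤ k ∧ entry σ k < entry σ (k - 1)) ∧
        (k < 2 * n + 1 ∧ entry σ k < entry σ (k + 1)) := by
  simp only [oddOddPermsStar, oddOddPerms, mem_filter, mem_univ, true_and]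
  simp only [IsDescentAt, mem_Icc, mem_Ico, gt_iff_lt]
  constructor
  · rintro ⟨h, hl⟩ k hk
    rw [or_iff_not_imp_left]
    intro ho
    refine ⟨fun hB => ?_, ?_⟩
    · have := (h (k - 1) (by omega) ⟨by omega, by rw [show k - 1 + 1 = k by omega]; exact hB.2⟩).2
      rw [show k - 1 + 1 = k by omega] at this
      exact ho this
    · have hkN : k < 2 * n + 1 := lt_of_le_of_ne hk.2 fun h => ho (h ▸ hl)
      refine ⟨hkN, ?_⟩
      by_contra hlt
      have hne : entry σ k ≠ entry σ (k + 1) := fun he => by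
        have := injOn_entry σ (by simp; omega) (by simp; omega) he
        omega
      exact ho (h k (by omega) ⟨by omega, by omega⟩).1
  · intro h
    refine ⟨fun i hi hd => ⟨?_, ?_⟩, ?_⟩
    · rcases h i (by omega) with h | h
      · exact h
      · omega
    · rcases h (i + 1) (by omega) with h | h
      · exact h
      · exact (h.1 ⟨by omega, by simpa using hd.2⟩).elim
    · rcases h (2 * n + 1) (by omega) with h | h
      · exact h
      · omega

theorem prod_weightY (a p q y t : R) (σ : Equiv.Perm (Fin (2 * n + 1))) :
    ∏ u ∈ Icc 1 (2 * n + 1),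
        letterWeight (weightY a p q y t) u ((List.range' 1 (2 * n + 1)).map (entry σ)) =
      if σ ∈ oddOddPermsStar n then
        a ^ lema σ * p ^ resAsc σ * q ^ les σ * y ^ dd σ * t ^ des σ else 0 := by
  rw [prod_Icc_eq_prod_comp (injOn_entry σ) fun k hk => entry_mem σ hk]
  have hw : ∀ k ∈ Icc 1 (2 * n + 1),
      letterWeight (weightY a p q y t) (entry σ k)
        ((List.range' 1 (2 * n + 1)).map (entry σ)) =
      weightY a p q y t (entry σ k) false
        #{i ∈ Ico 1 (k - 1) | entry σ k < entry σ i ∧ entry σ (i + 1) < entry σ k}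
        #{j ∈ Ico (k + 1) (2 * n + 1) | entry σ j < entry σ k ∧ entry σ k < entry σ (j + 1)}
        (decide (2 ≤ k ∧ entry σ k < entry σ (k - 1)))
        (decide (k < 2 * n + 1 ∧ entry σ k < entry σ (k + 1))) := fun k hk => by
    rw [letterWeight, leftStraddle_map_range' (injOn_entry σ) hk,
      rightStraddle_map_range' (injOn_entry σ) hk, predAbove_map_range' (injOn_entry σ) hk,
      succAbove_map_range' (injOn_entry σ) hk]
    -- `weightY` ignores its flag, so the flag may be replaced by `false`.
    rfl
  rw [prod_congr rfl hw]
  split_ifs with hσ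
  · rw [mem_oddOddPermsStar_iff] at hσ
    -- The conventions σ₀ = σ_{N+1} = 0 exclude the first position and count the last one when its
    -- predecessor is larger, which agrees with the absence of a larger successor there.
    have hdd : dd σ = #{k ∈ Icc 1 (2 * n + 1) | (2 ≤ k ∧ entry σ k < entry σ (k - 1)) ∧
        ¬(k < 2 * n + 1 ∧ entry σ k < entry σ (k + 1))} := by
      rw [dd]
      congr 1
      refine filter_congr fun k hk => ?_
      have hk' := mem_Icc.1 hk
      have hpos := mem_Icc.1 (entry_mem σ hk)
      refine and_congr ⟨fun h => ⟨?_, h⟩, fun h => h.2⟩ ?_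
      · by_contra h2
        obtain rfl : k = 1 := by omega
        simp [entry] at h
      · rcases hk'.2.lt_or_eq with hlt | rfl
        · have hne : entry σ k ≠ entry σ (k + 1) := fun he => by
            have := injOn_entry σ (by simp; omega) (by simp; omega) he
            omega
          omega
        · have : entry σ (2 * n + 1 + 1) = 0 := by simp [entry]
          omega
    -- Even letters here never follow a larger one, so only the straddling descents decide whether
    -- they are left-to-right maxima.
    have hlema : lema σ = #{k ∈ Icc 1 (2 * n + 1) | Even (entry σ k) ∧
        #{i ∈ Ico 1 (k - 1) | entry σ k < entry σ i ∧ entry σ (i + 1) < entry σ k} = 0} := by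
      rw [lema]
      congr 1
      refine filter_congr fun k hk => ?_
      rw [IsLeftToRightMax, forall_lt_iff_straddle (injOn_entry σ) hk, and_comm]
      refine and_congr_right fun he => ?_
      have := (hσ k hk).resolve_left (Nat.not_odd_iff_even.2 he)
      exact and_iff_left this.1
    rw [← sum_leftStraddle_eq_les, ← sum_rightStraddle_eq_resAsc, ← card_predAbove_eq_des, hdd,
      hlema, ← prod_pow_eq_pow_sum, ← prod_pow_eq_pow_sum, ← prod_ite_one_eq_pow,
      ← prod_ite_one_eq_pow, ← prod_ite_one_eq_pow, ← prod_mul_distrib, ← prod_mul_distrib,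
      ← prod_mul_distrib, ← prod_mul_distrib]
    refine prod_congr rfl fun k hk => ?_
    rcases Nat.even_or_odd (entry σ k) with he | ho
    · have ho := Nat.not_odd_iff_even.2 he
      have := (hσ k hk).resolve_left ho
      simp only [weightY, if_neg ho, he, this]
      simp only [true_and]
      simp
      split_ifs <;> ring
    · have he := Nat.not_even_iff_odd.2 ho
      simp only [weightY, if_pos ho, he, decide_eq_true_eq]
      simp only [false_and, if_false]
      split_ifs <;> ring
  · rw [mem_oddOddPermsStar_iff] at hσ
    push Not at hσ
    obtain ⟨k, hk, ho, h⟩ := hσ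
    refine prod_eq_zero hk ?_
    rw [weightY, if_neg ho, if_pos]
    simp only [decide_eq_true_eq]
    grind

end TermY

/-! ### The terms of X as products of letter weights, after appending 2n + 1 -/

section TermX

variable {R : Type*} [CommRing R] {n : ℕ}

theorem mem_evenOddPerms_iff (σ : Equiv.Perm (Fin (2 * n))) :
    σ ∈ evenOddPerms n ↔ ∀ k ∈ Icc 1 (2 * n),
      (Odd (entry σ k) → ¬(k < 2 * n ∧ entry σ (k + 1) < entry σ k)) ∧
      (Even (entry σ k) → ¬(2 ≤ k ∧ entry σ k < entry σ (k - 1))) := by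
  simp only [evenOddPerms, mem_filter, mem_univ, true_and]
  simp only [IsDescentAt, mem_Icc, mem_Ico, gt_iff_lt]
  constructor
  · intro h k hk
    refine ⟨fun ho hd => ?_, fun he hd => ?_⟩
    · exact Nat.not_even_iff_odd.2 ho (h k (by omega) ⟨by omega, hd.2⟩).1
    · have := (h (k - 1) (by omega) ⟨by omega, by rw [show k - 1 + 1 = k by omega]; exact hd.2⟩).2
      rw [show k - 1 + 1 = k by omega] at this
      exact Nat.not_odd_iff_even.2 he this
  · intro h i hi hd
    constructor
    · by_contra hne
      exact (h i (by omega)).1 (Nat.not_even_iff_odd.1 hne) ⟨hi.2, hd.2⟩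
    · by_contra hno
      exact (h (i + 1) (by omega)).2 (Nat.not_odd_iff_even.1 hno) ⟨by omega, hd.2⟩

/-- The entries of a permutation of `[N]`, followed by `N + 1`. -/
def entrySucc {N : ℕ} (σ : Equiv.Perm (Fin N)) (k : ℕ) : ℕ := if k ≤ N then entry σ k else N + 1

variable {N : ℕ} (σ : Equiv.Perm (Fin N))

theorem entrySucc_of_le {k : ℕ} (hk : k ≤ N) : entrySucc σ k = entry σ k := if_pos hk

theorem entrySucc_last : entrySucc σ (N + 1) = N + 1 := if_neg (by omega)

theorem injOn_entrySucc : Set.InjOn (entrySucc σ) (Icc 1 (N + 1)) := by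
  intro i hi j hj h
  rw [mem_coe, mem_Icc] at hi hj
  have hm := fun k hk => mem_Icc.1 (entry_mem σ (k := k) hk)
  simp only [mem_Icc] at hm
  rw [entrySucc, entrySucc] at h
  split_ifs at h with h1 h2 h2
  · exact injOn_entry σ (by simp; omega) (by simp; omega) h
  · have := hm i (by omega)
    omega
  · have := hm j (by omega)
    omega
  · omega

theorem map_entrySucc : (List.range' 1 (N + 1)).map (entrySucc σ) =
    (List.range' 1 N).map (entry σ) ++ [N + 1] := by
  rw [List.range'_concat, List.map_append, one_mul, List.map_singleton, add_comm 1 N,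
    entrySucc_last]
  congr 1
  refine List.map_congr_left fun k hk => ?_
  rw [List.mem_range'_1] at hk
  exact entrySucc_of_le σ (by omega)

/-- With N + 1 appended, every letter of σ has a successor, so having no larger one means being a
descent top. -/
theorem succAbove_entrySucc {k : ℕ} (hk : k ∈ Icc 1 N) :
    succAbove (entry σ k) ((List.range' 1 (N + 1)).map (entrySucc σ)) =
      !decide (k < N ∧ entry σ (k + 1) < entry σ k) := by
  have hm := mem_Icc.1 (entry_mem σ hk)
  rw [mem_Icc] at hk
  rw [← entrySucc_of_le σ hk.2, succAbove_map_range' (injOn_entrySucc σ) (by rw [mem_Icc]; omega),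
    ← decide_not, decide_eq_decide, entrySucc_of_le σ hk.2]
  rcases hk.2.lt_or_eq with h | rfl
  · rw [entrySucc_of_le σ (k := k + 1) h]
    have hne : entry σ k ≠ entry σ (k + 1) := fun he => by
      have := injOn_entry σ (by simp; omega) (by simp; omega) he
      omega
    omega
  · rw [entrySucc_last]
    omega

theorem predAbove_entrySucc {k : ℕ} (hk : k ∈ Icc 1 N) :
    predAbove (entry σ k) ((List.range' 1 (N + 1)).map (entrySucc σ)) =
      decide (2 ≤ k ∧ entry σ k < entry σ (k - 1)) := by
  rw [mem_Icc] at hk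
  rw [← entrySucc_of_le σ hk.2, predAbove_map_range' (injOn_entrySucc σ) (by rw [mem_Icc]; omega),
    entrySucc_of_le σ hk.2, entrySucc_of_le σ (by omega)]

theorem leftStraddle_entrySucc {k : ℕ} (hk : k ∈ Icc 1 N) :
    leftStraddle (entry σ k) ((List.range' 1 (N + 1)).map (entrySucc σ)) =
      #{i ∈ Ico 1 (k - 1) | entry σ k < entry σ i ∧ entry σ (i + 1) < entry σ k} := by
  rw [mem_Icc] at hk
  rw [← entrySucc_of_le σ hk.2,
    leftStraddle_map_range' (injOn_entrySucc σ) (by rw [mem_Icc]; omega)]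
  congr 1
  refine filter_congr fun i hi => ?_
  rw [mem_Ico] at hi
  rw [entrySucc_of_le σ (by omega), entrySucc_of_le σ (by omega), entrySucc_of_le σ (by omega)]

/-- After position k the straddling ascents and descents alternate and the word ends above `entry σ
k`, so ascents exceed descents by one exactly when the next letter is smaller. -/
theorem rightStraddle_entrySucc {k : ℕ} (hk : k ∈ Icc 1 N) :
    rightStraddle (entry σ k) ((List.range' 1 (N + 1)).map (entrySucc σ)) =
      #{j ∈ Ico (k + 1) N | entry σ k < entry σ j ∧ entry σ (j + 1) < entry σ k} +
        if k < N ∧ entry σ (k + 1) < entry σ k then 1 else 0 := by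
  have hm := mem_Icc.1 (entry_mem σ hk)
  rw [mem_Icc] at hk
  have hlt : entrySucc σ k < N + 1 := by rw [entrySucc_of_le σ hk.2]; omega
  have hne : ∀ j ∈ Icc (k + 1) (k + 1 + (N - k)), entrySucc σ j ≠ entrySucc σ k := by
    intro j hj he
    rw [mem_Icc] at hj
    have := injOn_entrySucc σ (by simp; omega) (by simp; omega) he
    omega
  have key := card_ascents_eq_card_descents (e := entrySucc σ) (u := entrySucc σ k)
    (m := N - k) (s := k + 1)
    (by rw [show k + 1 + (N - k) = N + 1 by omega, entrySucc_last]; exact hlt) hne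
  rw [← entrySucc_of_le σ hk.2,
    rightStraddle_map_range' (injOn_entrySucc σ) (by rw [mem_Icc]; omega)]
  rw [show k + 1 + (N - k) = N + 1 by omega] at key hne
  rw [key]
  congr 1
  · congr 1
    ext j
    simp only [mem_filter, mem_Ico]
    constructor
    · rintro ⟨h1, h2, h3⟩
      -- The step into the appended letter N + 1 is never a straddling descent.
      have hj : j ≠ N := by
        rintro rfl
        rw [entrySucc_last] at h3
        omega
      rw [entrySucc_of_le σ (k := j) (by omega)] at h2
      rw [entrySucc_of_le σ (k := j + 1) (by omega)] at h3
      exact ⟨by omega, h2, h3⟩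
    · rintro ⟨h1, h2, h3⟩
      rw [entrySucc_of_le σ (k := j) (by omega), entrySucc_of_le σ (k := j + 1) (by omega)]
      exact ⟨by omega, h2, h3⟩
  · rw [← ite_not]
    refine if_congr ?_ rfl rfl
    rcases hk.2.lt_or_eq with h | rfl
    · have := hne (k + 1) (by rw [mem_Icc]; omega)
      rw [entrySucc_of_le σ (k := k + 1) (by omega), entrySucc_of_le σ (by omega)] at *
      omega
    · rw [entrySucc_last]
      omega

theorem isDescentBottom_iff {v : ℕ} (hv : v ∈ Icc 1 N) :
    IsDescentBottom σ v ↔ predAbove v ((List.range' 1 (N + 1)).map (entrySucc σ)) = true := by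
  obtain ⟨k, hk, rfl⟩ : ∃ k ∈ Icc 1 N, entry σ k = v := by
    have := (perm_of_injOn (injOn_entry σ) fun k hk => entry_mem σ hk).mem_iff (a := v)
    simp only [List.mem_map, List.mem_range'_1] at this
    rw [mem_Icc] at hv
    obtain ⟨k, hk, h⟩ := this.2 (by omega)
    exact ⟨k, by rw [mem_Icc]; omega, h⟩
  rw [predAbove_entrySucc σ hk, decide_eq_true_eq]
  have hk' := mem_Icc.1 hk
  simp only [IsDescentBottom, IsDescentAt, mem_Ico, gt_iff_lt]
  constructor
  · rintro ⟨i, hi, hd, he⟩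
    have := injOn_entry σ (by simp; omega) (by simp; omega) he
    subst this
    exact ⟨by omega, by simpa using hd.2⟩
  · rintro ⟨h1, h2⟩
    refine ⟨k - 1, by omega, ?_, ?_⟩
    · rw [show k - 1 + 1 = k by omega]
      exact ⟨by omega, h2⟩
    · rw [show k - 1 + 1 = k by omega]

/-- The domino j corresponds to the position of the letter 2j; its partner 2j - 1 is the preceding
value, whose status the flag in the weight records. -/
theorem card_eq_dom (σ : Equiv.Perm (Fin (2 * n))) :
    #{k ∈ Icc 1 (2 * n) | Even (entry σ k) ∧ (k < 2 * n ∧ entry σ (k + 1) < entry σ k) ∧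
      predAbove (entry σ k - 1) ((List.range' 1 (2 * n + 1)).map (entrySucc σ)) = true} =
      dom σ := by
  rw [dom]
  refine card_nbij (fun k => entry σ k / 2) ?_ ?_ ?_
  · intro k h
    simp only [mem_coe, mem_filter] at h ⊢
    obtain ⟨hk, he, hd, hp⟩ := h
    have hm := mem_Icc.1 (entry_mem σ hk)
    obtain ⟨j, hj⟩ := he
    have hj2 : entry σ k / 2 = j := by omega
    rw [mem_Icc] at hk
    rw [hj2]
    refine ⟨by rw [mem_Icc]; omega, ⟨k, by rw [mem_Ico]; omega, ⟨by rw [mem_Ico]; omega, hd.2⟩,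
      by omega⟩, ?_⟩
    rw [isDescentBottom_iff σ (by rw [mem_Icc]; omega)]
    rwa [show 2 * j - 1 = entry σ k - 1 by omega]
  · intro k h k' h' he
    simp only [mem_coe, mem_filter] at h h'
    obtain ⟨j, hj⟩ := h.2.1
    obtain ⟨j', hj'⟩ := h'.2.1
    simp only at he
    exact injOn_entry σ (mem_coe.2 h.1) (mem_coe.2 h'.1) (by omega)
  · intro j h
    simp only [mem_coe, mem_filter] at h
    obtain ⟨hj, ⟨k, hk, hd, he⟩, hb⟩ := h
    rw [mem_Icc] at hj
    rw [mem_Ico] at hk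
    refine ⟨k, ?_, by simp only; omega⟩
    simp only [mem_coe, mem_filter]
    refine ⟨by rw [mem_Icc]; omega, ⟨j, by omega⟩, ⟨hk.2, hd.2⟩, ?_⟩
    rw [isDescentBottom_iff σ (by rw [mem_Icc]; omega)] at hb
    rwa [he]

/-- For a descent top the count of ascents is one more than the count of descents in `resDesc`; the
exponent j - 1 in `weightX` compensates for this. -/
theorem prod_weightX (a p q y t : R) (σ : Equiv.Perm (Fin (2 * n))) :
    ∏ u ∈ Icc 1 (2 * n + 1), letterWeight (weightX n a p q y t) u
        ((List.range' 1 (2 * n + 1)).map (entrySucc σ)) =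
      if σ ∈ evenOddPerms n then
        a ^ lema σ * p ^ resDesc σ * q ^ les σ * y ^ dom σ * t ^ des σ else 0 := by
  rw [prod_Icc_succ_top (by omega), letterWeight, weightX, if_pos rfl, mul_one,
    prod_Icc_eq_prod_comp (injOn_entry σ) fun k hk => entry_mem σ hk]
  have hw : ∀ k ∈ Icc 1 (2 * n), letterWeight (weightX n a p q y t) (entry σ k)
        ((List.range' 1 (2 * n + 1)).map (entrySucc σ)) =
      weightX n a p q y t (entry σ k)
        (predAbove (entry σ k - 1) ((List.range' 1 (2 * n + 1)).map (entrySucc σ)))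
        #{i ∈ Ico 1 (k - 1) | entry σ k < entry σ i ∧ entry σ (i + 1) < entry σ k}
        (#{j ∈ Ico (k + 1) (2 * n) | entry σ k < entry σ j ∧ entry σ (j + 1) < entry σ k} +
          if k < 2 * n ∧ entry σ (k + 1) < entry σ k then 1 else 0)
        (decide (2 ≤ k ∧ entry σ k < entry σ (k - 1)))
        (!decide (k < 2 * n ∧ entry σ (k + 1) < entry σ k)) := fun k hk => by
    rw [letterWeight, leftStraddle_entrySucc σ hk, rightStraddle_entrySucc σ hk,
      succAbove_entrySucc σ hk, predAbove_entrySucc σ hk]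
  rw [prod_congr rfl hw]
  have hlast : ∀ k ∈ Icc 1 (2 * n), entry σ k ≠ 2 * n + 1 := fun k hk h => by
    have := mem_Icc.1 (entry_mem σ hk)
    omega
  split_ifs with hσ
  · rw [mem_evenOddPerms_iff] at hσ
    have hlema : lema σ = #{k ∈ Icc 1 (2 * n) | Even (entry σ k) ∧
        #{i ∈ Ico 1 (k - 1) | entry σ k < entry σ i ∧ entry σ (i + 1) < entry σ k} = 0} := by
      rw [lema]
      congr 1
      refine filter_congr fun k hk => ?_
      rw [IsLeftToRightMax, forall_lt_iff_straddle (injOn_entry σ) hk, and_comm]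
      refine and_congr_right fun he => ?_
      exact and_iff_left ((hσ k hk).2 he)
    rw [← sum_leftStraddle_eq_les, ← sum_rightStraddle_eq_resDesc, ← card_predAbove_eq_des,
      ← card_eq_dom, hlema, ← prod_pow_eq_pow_sum, ← prod_pow_eq_pow_sum, ← prod_ite_one_eq_pow,
      ← prod_ite_one_eq_pow, ← prod_ite_one_eq_pow, ← prod_mul_distrib, ← prod_mul_distrib,
      ← prod_mul_distrib, ← prod_mul_distrib]
    refine prod_congr rfl fun k hk => ?_
    rw [weightX, if_neg (hlast k hk)]
    rcases Nat.even_or_odd (entry σ k) with he | ho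
    · have hB := (hσ k hk).2 he
      rw [if_neg (Nat.not_odd_iff_even.2 he)]
      simp only [he, hB]
      by_cases hC : k < 2 * n ∧ entry σ (k + 1) < entry σ k
      · simp only [hC]
        simp
        split_ifs <;> ring
      · simp only [hC]
        simp
        split_ifs <;> ring
    · have hC := (hσ k hk).1 ho
      rw [if_pos ho]
      simp only [Nat.not_even_iff_odd.2 ho, hC, decide_eq_true_eq]
      simp
      split_ifs <;> ring
  · rw [mem_evenOddPerms_iff] at hσ
    push Not at hσ
    obtain ⟨k, hk, h⟩ := hσ
    refine prod_eq_zero hk ?_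
    rw [weightX, if_neg (hlast k hk)]
    rcases Nat.even_or_odd (entry σ k) with he | ho
    · have hB := (h fun ho => (Nat.not_odd_iff_even.2 he ho).elim).2
      rw [if_neg (Nat.not_odd_iff_even.2 he), if_pos (by simpa using hB)]
    · have hC : k < 2 * n ∧ entry σ (k + 1) < entry σ k := by
        by_contra hC
        exact Nat.not_odd_iff_even.2 (h fun _ h1 => not_lt.1 fun h2 => hC ⟨h1, h2⟩).1 ho
      rw [if_pos ho, if_neg (by simpa using hC)]

/-- A last letter that is not the largest one has weight `0`. -/
theorem prod_weightX_append_eq_zero (a p q y t : R) {w : List ℕ} {x : ℕ} (h1 : 1 ≤ x)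
    (hx : x ≤ 2 * n) (hw : x ∉ w) :
    ∏ u ∈ Icc 1 (2 * n + 1), letterWeight (weightX n a p q y t) u (w ++ [x]) = 0 := by
  refine prod_eq_zero (i := x) (by rw [mem_Icc]; omega) ?_
  simp [letterWeight, weightX, rightStraddle, succAbove, after_append_cons hw, headAbove,
    crossings, show x ≠ 2 * n + 1 by omega]

end TermX

/-! ### Both polynomials as transfers starting from one gap -/

theorem polyX_eq_transfer {R : Type*} [CommRing R] (n : ℕ) (a p q y t : R) :
    polyX n a 1 1 1 p q y t =
      transfer (weightX n a p q y t) (2 * n + 1) 0 (predAbove 0 [2 * n + 2]) 1 := by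
  rw [← sum_permutations_eq_transfer _ (Nat.succ_pos _),
    ← sum_words_succ (2 * n) fun w =>
      ∏ u ∈ Icc 1 (2 * n + 1), letterWeight (weightX n a p q y t) u w,
    ← sum_perm_eq_sum_words (2 * n) fun w =>
      ∏ u ∈ Icc 1 (2 * n + 1), letterWeight (weightX n a p q y t) u (w ++ [2 * n + 1])]
  · simp only [← map_entrySucc, prod_weightX]
    rw [sum_ite_mem, univ_inter, polyX]
    simp
  · intro w x hx h1 hw
    exact prod_weightX_append_eq_zero a p q y t h1 hx hw

theorem polyY_eq_transfer {R : Type*} [CommRing R] (n : ℕ) (a p q y t : R) :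
    polyY n a p q y t =
      transfer (weightY a p q y t) (2 * n + 1) 0 (predAbove 0 [2 * n + 2]) 1 := by
  rw [← sum_permutations_eq_transfer _ (Nat.succ_pos _),
    ← sum_perm_eq_sum_words (2 * n + 1) fun w =>
      ∏ u ∈ Icc 1 (2 * n + 1), letterWeight (weightY a p q y t) u w]
  simp only [prod_weightY]
  rw [sum_ite_mem, univ_inter, polyY]

end Genocchi

theorem mainTheorem5 {R : Type*} [CommRing R] (n : ℕ) (hn : 1 ≤ n) (a p q y t : R) :
    Genocchi.polyY n a p q y t = Genocchi.polyX n a 1 1 1 p q y t := by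
  rw [Genocchi.polyX_eq_transfer, Genocchi.polyY_eq_transfer,
    Genocchi.transfer_weightX_eq_weightY n a p q y t (zero_add _)]
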